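/- **Setting.** Nature draws i.i.d. vectors $(x_t,r_1(t),\dots,r_K(t))$ with rewards $r_v(t)\in[0,1]$. There are $N\ge 2$ stochastic experts, i.e. conditional distributions $\pi_1(\cdot|x),\dots,\pi_N(\cdot|x)$ over the $K$ arms. At time $t$ the policy selects an expert $k(t)$ from its past observations, the context $x_t$ is observed, an arm $v(t)\sim\pi_{k(t)}(\cdot|x_t)$ is drawn, and $Y(t)=r_{v(t)}(t)$ is observed. Let $p_k$ be the law of $(x,v,Y)$ under expert $k$, $\mu_k=\mathbb E_{p_k}[Y]$, $\mu^*=\max_k\mu_k$, $\Delta_k=\mu^*-\mu_k$, and let $0=\Delta_{(1)}\le\dots\le\Delta_{(N)}$ be the sorted gaps. Put $$\lambda(\mu)=1+\sum_{k=2}^{N-1}\Bigl(1-\frac{\Delta_{(k)}^2}{\Delta_{(k+1)}^2}\Bigr),\qquad R(T)=\mathbb E\sum_{t=1}^{T}(\mu^*-\mu_{k(t)}).$$ With $D_f(\pi_i\|\pi_j)=\mathbb E_{p_j}[f(\pi_i(V|X)/\pi_j(V|X))]$ (infinite, for the functions below, if $\pi_i$ is not absolutely continuous with respect to $\pi_j$),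 let $M_{ij}=1+\log(1+D_{f_1}(\pi_i\|\pi_j))$ for $f_1(x)=xe^{x-1}-1$, $\sigma_{ij}^2=1+D_{f_2}(\pi_i\|\pi_j)$ for $f_2(x)=x^2-1$, $M=\max_{i,j}M_{ij}$ and $\sigma=\max_{i,j}\sigma_{ij}$. **Algorithm (D-UCB).** The first expert is arbitrary; at time $t+1$ select $k(t+1)\in\arg\max_k U_k(t)$, $U_k(t)=\hat\mu_k(t)+s_k(t)$ (ties, and choices at times when $U$ is undefined, are arbitrary). Write $\rho_{k}(s)=\pi_k(v(s)|x_s)/\pi_{k(s)}(v(s)|x_s)$, and let $n_j(t)$ be the number of times $s\le t$ with $k(s)=j$. *Clipped estimator:* with $Z_k(t)=\sum_j n_j(t)/M_{kj}$, let $\beta=\beta_k(t)>0$ solve $\beta/\log(2/\beta)=\sqrt{16\,t\log t}/Z_k(t)$ (for $t\ge2$), and set $s_k(t)=\tfrac32\beta$ and $$\hat\mu_k(t)=\frac1{Z_k(t)}\sum_{s\le t}\frac{1}{M_{k,k(s)}}Y(s)\rho_k(s)\mathbf 1\{\rho_k(s)\le 2\log(2/\beta)M_{k,k(s)}\}.$$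 *Median-of-means estimator:* with $\delta(t)=1/t^2$ and $l(t)=\lfloor 8\log(1/\delta(t))\rfloor$, divide the samples $1,\dots,t$ into $l(t)$ groups so that each group contains at least $\lfloor n_i(t)/l(t)\rfloor$ samples from each expert $i$; the group of a sample may depend only on $t$ and the experts selected up to that sample. With $n_i(r,t)$ the number of samples from expert $i$ in group $r$, $n(r,t)=\sum_i n_i(r,t)$, $W_k(r,t)=\sum_i n_i(r,t)/\sigma_{ki}$ and $W_k(t)=\min_r W_k(r,t)/n(r,t)$, let $\hat\mu_k(t)$ be the median over $r$ of $\frac1{W_k(r,t)}\sum_{s\text{ in group }r}\frac{1}{\sigma_{k,k(s)}}Y(s)\rho_k(s)$, and set $s_k(t)=\frac1{W_k(t)}\sqrt{64\log(1/\delta(t))/t}$ (undefined while some group is empty). **Generative model.** Let $\Delta_{(2)}\in(0,1)$ be fixed, and let the problem instance be random, such that $\Delta_{(3)}\le\dots\le\Delta_{(N)}$ are the order statistics of $N-2$ i.i.d. uniform variables on $[\Delta_{(2)},1]$. Let $\mathbb E_{p_\Delta}$ be the expectation over the random instance; $M$, $\sigma$ and $R(T)$ are functions of the instance. **Claim.**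 $\mathbb E_{p_\Delta}[\lambda(\mu)]\le 1+2\log N$. Moreover there are a universal constant $C$ and, for each $N\ge2$, a time $T_0=T_0(N)$ depending on $N$ only, such that for all such random instances and all $T\ge T_0$: (i) if $M<\infty$ almost surely, then D-UCB with the clipped estimator satisfies $$\mathbb E_{p_\Delta}\!\left[\frac{R(T)}{M^2}\right]\le C\,\frac{\log N\,\log^2(6/\Delta_{(2)})\,\log T}{\Delta_{(2)}};$$ (ii) if $\sigma<\infty$ almost surely, then D-UCB with the median-of-means estimator satisfies $$\mathbb E_{p_\Delta}\!\left[\frac{R(T)}{\sigma^2}\right]\le C\,\frac{\log N\,\log T}{\Delta_{(2)}}.$$ In particular, where $M\le M_0$ (or $\sigma\le\sigma_0$) with a constant $M_0$ ($\sigma_0$), the regret $R(T)$ itself, averaged over the instances with this property, is $O(M_0^2\log N\log^2(6/\Delta_{(2)})\log T/\Delta_{(2)})$ (respectively $O(\sigma_0^2\log N\log T/\Delta_{(2)})$). -/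

import Mathlib

open MeasureTheory ProbabilityTheory

noncomputable section

namespace StochasticExperts

/-! ### Order statistics -/

/-- The `k`-th smallest (`k = 1, …, n`) of the numbers `x 0, …, x (n - 1)`. -/
def orderStat {n : ℕ} (x : Fin n → ℝ) (k : ℕ) : ℝ :=
  if h : k - 1 < n then x (Tuple.sort x ⟨k - 1, h⟩) else 0

/-- The median of `n ≥ 1` numbers (mean of the two middle values when `n` is even). -/
def median {n : ℕ} (x : Fin n → ℝ) : ℝ :=
  (orderStat x ((n + 1) / 2) + orderStat x (n / 2 + 1)) / 2

/-! ### Contextual bandits with stochastic experts -/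

/-- A problem instance with contexts in `𝒳`, `K` arms and `N` stochastic experts: nature's law of
`(x, r_1, …, r_K)`, with rewards in `[0, 1]`, and for each expert a conditional distribution over
the arms given the context. -/
structure Env (𝒳 : Type*) [MeasurableSpace 𝒳] (K N : ℕ) where
  nature : Measure (𝒳 × (Fin K → ℝ))
  isProb : IsProbabilityMeasure nature
  reward_mem : ∀ᵐ z ∂nature, ∀ v, z.2 v ∈ Set.Icc (0 : ℝ) 1
  expert : Fin N → Kernel 𝒳 (Fin K)
  isMarkov : ∀ i, IsMarkovKernel (expert i)

namespace Env

variable {𝒳 : Type*} [MeasurableSpace 𝒳] {K N : ℕ} (E : Env 𝒳 K N)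

/-- `π_i(v | x)`. -/
def prob (i : Fin N) (v : Fin K) (x : 𝒳) : ℝ := (E.expert i x).real {v}

/-- The importance ratio `π_i(v | x) / π_j(v | x)`. -/
def ratio (i j : Fin N) (v : Fin K) (x : 𝒳) : ℝ := E.prob i v x / E.prob j v x

/-- The joint law of `((x, r), v)`: `(x, r)` is drawn by nature, then the arm `v` is drawn from
`π_k(· | x)`. -/
def joint (k : Fin N) : Measure ((𝒳 × (Fin K → ℝ)) × Fin K) :=
  E.nature ⊗ₘ ((E.expert k).comap Prod.fst measurable_fst)

/-- The mean reward `μ_k` of expert `k`. -/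
def mean (k : Fin N) : ℝ := ∫ z, z.1.2 z.2 ∂(E.joint k)

/-- The mean reward `μ^*` of the best expert. -/
def bestMean : ℝ := ⨆ k, E.mean k

/-- The optimality gap `Δ_k = μ^* - μ_k`. -/
def gap (k : Fin N) : ℝ := E.bestMean - E.mean k

/-- `Δ_(k)`: the gaps in increasing order, `Δ_(1) ≤ … ≤ Δ_(N)`. -/
def sortedGap (k : ℕ) : ℝ := orderStat E.gap k

/-- `λ(μ) = 1 + ∑_{k=2}^{N-1} (1 - Δ_(k)^2 / Δ_(k+1)^2)`. -/
def lam : ℝ :=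
  1 + ∑ k ∈ Finset.Icc 2 (N - 1), (1 - E.sortedGap k ^ 2 / E.sortedGap (k + 1) ^ 2)

/-- The conditional `f`-divergence `D_f(π_i ‖ π_j)` (a real number; see `FiniteDiv`). -/
def condDiv (f : ℝ → ℝ) (i j : Fin N) : ℝ :=
  ∫ z, f (E.ratio i j z.2 z.1.1) ∂(E.joint j)

/-- `D_f(π_i ‖ π_j) < ∞`, for `f` bounded below with superlinear growth (for such an `f` the
divergence is infinite when `π_i` charges an arm that `π_j` does not). -/
def FiniteDiv (f : ℝ → ℝ) (i j : Fin N) : Prop :=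
  (∀ᵐ z ∂E.nature, E.expert i z.1 ≪ E.expert j z.1) ∧
    Integrable (fun z => f (E.ratio i j z.2 z.1.1)) (E.joint j)

/-- `f_1(x) = x exp(x - 1) - 1`. -/
def fLog (x : ℝ) : ℝ := x * Real.exp (x - 1) - 1

/-- `f_2(x) = x^2 - 1`. -/
def fChi (x : ℝ) : ℝ := x ^ 2 - 1

/-- The log-divergence measure `M_ij = 1 + log (1 + D_{f_1}(π_i ‖ π_j))`. -/
def logDiv (i j : Fin N) : ℝ := 1 + Real.log (1 + E.condDiv fLog i j)

/-- `σ_ij`, where `σ_ij^2 = 1 + D_{f_2}(π_i ‖ π_j)`. -/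
def chiDiv (i j : Fin N) : ℝ := Real.sqrt (1 + E.condDiv fChi i j)

/-- `M = max_{i,j} M_ij`. -/
def logDivMax : ℝ := ⨆ p : Fin N × Fin N, E.logDiv p.1 p.2

/-- `σ = max_{i,j} σ_ij`. -/
def chiDivMax : ℝ := ⨆ p : Fin N × Fin N, E.chiDiv p.1 p.2

end Env

/-! ### The two estimators and their upper confidence bounds -/

/-- The observations of one run: at time `s = 1, 2, …` the context, the chosen expert, the arm and
the observed reward. -/
structure Path (𝒳 : Type*) (K N : ℕ) where
  ctx : ℕ → 𝒳
  expert : ℕ → Fin N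
  arm : ℕ → Fin K
  reward : ℕ → ℝ

/-- The times `s ∈ {1, …, t}` at which expert `j` was selected. -/
def times {N : ℕ} (h : ℕ → Fin N) (j : Fin N) (t : ℕ) : Finset ℕ :=
  (Finset.Icc 1 t).filter (fun s => h s = j)

section Clipped

variable {𝒳 : Type*} [MeasurableSpace 𝒳] {K N : ℕ} (E : Env 𝒳 K N) (p : Path 𝒳 K N)

/-- `π_k(V(s) | X(s)) / π_j(V(s) | X(s))`. -/
def sampleRatio (k j : Fin N) (s : ℕ) : ℝ := E.ratio k j (p.arm s) (p.ctx s)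

/-- `Z_k(t) = ∑_j n_j(t) / M_kj`. -/
def clipZ (k : Fin N) (t : ℕ) : ℝ :=
  ∑ j, ((times p.expert j t).card : ℝ) / E.logDiv k j

open Classical in
/-- The clipped importance sampling estimator of `μ_k` at time `t` with parameter `ε`. -/
def clippedMean (k : Fin N) (t : ℕ) (ε : ℝ) : ℝ :=
  1 / clipZ E p k t * ∑ j, ∑ s ∈ times p.expert j t,
    1 / E.logDiv k j * p.reward s * sampleRatio E p k j s *
      (if sampleRatio E p k j s ≤ 2 * Real.log (2 / ε) * E.logDiv k j then 1 else 0)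

open Classical in
/-- The number `b > 0` with `b / log (2 / b) = c`; for `c > 0` it exists, is unique and is less
than `2`. -/
def betaSol (c : ℝ) : ℝ :=
  if h : ∃ b : ℝ, 0 < b ∧ b / Real.log (2 / b) = c then h.choose else 0

/-- `β(t)` for expert `k`: `β / log (2 / β) = √(c_1 t log t) / Z_k(t)`, with `c_1 = 16`. -/
def beta (k : Fin N) (t : ℕ) : ℝ :=
  betaSol (Real.sqrt (16 * t * Real.log t) / clipZ E p k t)

/-- The upper confidence bound built from the clipped estimator with `ε(t) = β(t)`. -/
def clippedUCB (k : Fin N) (t : ℕ) : ℝ :=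
  clippedMean E p k t (beta E p k t) + 3 / 2 * beta E p k t

end Clipped

/-- The number of groups `l(t) = ⌊c_2 log (1 / δ(t))⌋`, with `c_2 = 8` and `δ(t) = 1 / t^2`. -/
def numGroups (t : ℕ) : ℕ := ⌊8 * Real.log (1 / (1 / (t : ℝ) ^ 2))⌋₊

/-- A rule which, at each time `t` and for each sequence `h` of selected experts, divides the
samples `s = 1, …, t` into the groups `0, …, l(t) - 1` while preserving the fraction of samples
from each expert: each group receives at least `⌊n_i(t) / l(t)⌋` samples from expert `i`. The rule
does not look ahead: the group of a sample depends only on the experts selected up to that sample.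
Dealing the samples of each expert to the groups in turn is an example. -/
structure Grouping (N : ℕ) where
  group : ℕ → (ℕ → Fin N) → ℕ → ℕ
  group_lt : ∀ t h s, 0 < numGroups t → group t h s < numGroups t
  no_lookahead : ∀ t h h' s, (∀ u, 1 ≤ u → u ≤ s → h u = h' u) → group t h s = group t h' s
  balanced : ∀ t h i r, r < numGroups t →
    (times h i t).card / numGroups t ≤ ((times h i t).filter (fun s => group t h s = r)).card

section MedianOfMeans

variable {𝒳 : Type*} [MeasurableSpace 𝒳] {K N : ℕ} (E : Env 𝒳 K N) (G : Grouping N)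
  (p : Path 𝒳 K N)

/-- The samples from expert `j` in group `r` at time `t`. -/
def groupTimes (j : Fin N) (r t : ℕ) : Finset ℕ :=
  (times p.expert j t).filter (fun s => G.group t p.expert s = r)

/-- `n(r, t)`, the number of samples in group `r`. -/
def groupSize (r t : ℕ) : ℕ := ∑ j, (groupTimes G p j r t).card

/-- `W_k(r, t) = ∑_i n_i(r, t) / σ_ki`. -/
def groupW (k : Fin N) (r t : ℕ) : ℝ :=
  ∑ j, ((groupTimes G p j r t).card : ℝ) / E.chiDiv k j

/-- The importance sampling estimator of `μ_k` from group `r`. -/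
def groupMean (k : Fin N) (t r : ℕ) : ℝ :=
  1 / groupW E G p k r t * ∑ j, ∑ s ∈ groupTimes G p j r t,
    1 / E.chiDiv k j * p.reward s * sampleRatio E p k j s

/-- The median of means estimator of `μ_k`. -/
def momMean (k : Fin N) (t : ℕ) : ℝ :=
  median (fun r : Fin (numGroups t) => groupMean E G p k t r)

/-- `W_k(t) = min_r W_k(r, t) / n(r, t)`. -/
def minW (k : Fin N) (t : ℕ) : ℝ :=
  ⨅ r : Fin (numGroups t), groupW E G p k r t / groupSize G p r t

/-- The upper confidence bound built from the median of means estimator, with `c_3 = 64` and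
`δ(t) = 1 / t^2`. -/
def momUCB (k : Fin N) (t : ℕ) : ℝ :=
  momMean E G p k t +
    1 / minW E G p k t * Real.sqrt (64 * Real.log (1 / (1 / (t : ℝ) ^ 2)) / t)

/-- The median of means estimator is defined at time `t`: there is a group, and no group is
empty. -/
def MomDefined (t : ℕ) : Prop :=
  0 < numGroups t ∧ ∀ r < numGroups t, 0 < groupSize G p r t

end MedianOfMeans

/-! ### Runs of the algorithm -/

/-- The interaction of a policy with the instance `E`, on the measurable space `Ω`. At each time
`t + 1` the expert is selected on the basis of the information `ℱ t`; given this information, the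
new `((x, r), v)` has the law `E.joint` of the selected expert. -/
structure Run {𝒳 : Type*} [MeasurableSpace 𝒳] {K N : ℕ} (E : Env 𝒳 K N)
    (Ω : Type*) [mΩ : MeasurableSpace Ω] where
  law : Measure Ω
  isProb : IsProbabilityMeasure law
  ℱ : Filtration ℕ mΩ
  ctx : ℕ → Ω → 𝒳
  rewards : ℕ → Ω → (Fin K → ℝ)
  expert : ℕ → Ω → Fin N
  arm : ℕ → Ω → Fin K
  expert_meas : ∀ t, Measurable[ℱ t] (expert (t + 1))
  ctx_meas : ∀ t, Measurable[ℱ (t + 1)] (ctx (t + 1))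
  rewards_meas : ∀ t, Measurable[ℱ (t + 1)] (rewards (t + 1))
  arm_meas : ∀ t, Measurable[ℱ (t + 1)] (arm (t + 1))
  step_law : ∀ t A, MeasurableSet[ℱ t] A →
    ∀ B : Set ((𝒳 × (Fin K → ℝ)) × Fin K), MeasurableSet B →
      law (A ∩ {ω | ((ctx (t + 1) ω, rewards (t + 1) ω), arm (t + 1) ω) ∈ B}) =
        ∫⁻ ω in A, E.joint (expert (t + 1) ω) B ∂law

namespace Run

variable {𝒳 : Type*} [MeasurableSpace 𝒳] {K N : ℕ} {E : Env 𝒳 K N}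
  {Ω : Type*} [MeasurableSpace Ω] (run : Run E Ω)

/-- What the policy observes; the reward at time `s` is `r_{v(s)}(s)`. -/
def path (ω : Ω) : Path 𝒳 K N where
  ctx s := run.ctx s ω
  expert s := run.expert s ω
  arm s := run.arm s ω
  reward s := run.rewards s ω (run.arm s ω)

/-- The expected regret until time `T`: the mean of `∑_{t=1}^T (μ^* - μ_{k(t)})`. -/
def regret (T : ℕ) : ℝ :=
  ∫ ω, ∑ t ∈ Finset.Icc 1 T, (E.bestMean - E.mean (run.expert t ω)) ∂run.law

/-- The run follows D-UCB with the clipped estimator. The first expert, the second one (as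
`β(1)` is undefined: `log 1 = 0`) and the way ties are broken are arbitrary. -/
def IsClippedUCB : Prop :=
  ∀ᵐ ω ∂run.law, ∀ t, 2 ≤ t → ∀ j,
    clippedUCB E (run.path ω) j t ≤ clippedUCB E (run.path ω) (run.expert (t + 1) ω) t

/-- The run follows D-UCB with the median of means estimator. The first expert, the expert
selected while the estimator is still undefined and the way ties are broken are arbitrary. -/
def IsMomUCB (G : Grouping N) : Prop :=
  ∀ᵐ ω ∂run.law, ∀ t, MomDefined G (run.path ω) t → ∀ j,
    momUCB E G (run.path ω) j t ≤ momUCB E G (run.path ω) (run.expert (t + 1) ω) t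

end Run

/-! ### The generative model for the gaps -/

/-- A random instance `E` such that `Δ_(2) = d` and `Δ_(3) ≤ … ≤ Δ_(N)` are the order statistics
of the `N - 2` variables `U`, which are independent and uniform on `[d, 1]`. -/
structure UniformGaps {𝒳 : Type*} [MeasurableSpace 𝒳] {K N : ℕ} {Θ : Type*} [MeasurableSpace Θ]
    (P : Measure Θ) (E : Θ → Env 𝒳 K N) (d : ℝ) (U : Fin (N - 2) → Θ → ℝ) : Prop where
  indep : iIndepFun U P
  uniform : ∀ i, pdf.IsUniform (U i) (Set.Icc d 1) P volume
  second : ∀ᵐ θ ∂P, (E θ).sortedGap 2 = d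
  rest : ∀ᵐ θ ∂P, ∀ k, 3 ≤ k → k ≤ N →
    (E θ).sortedGap k = orderStat (fun i => U i θ) (k - 2)

end StochasticExperts

end

namespace StochasticExperts

open scoped ENNReal

/-! ### Order statistics and medians -/

theorem card_filter_sort {n : ℕ} (x : Fin n → ℝ) (q : ℝ → Prop) [DecidablePred q] :
    (Finset.univ.filter fun i => q ((x ∘ Tuple.sort x) i)).card =
      (Finset.univ.filter fun i => q (x i)).card :=
  Finset.card_equiv (Tuple.sort x) (by simp)

theorem orderStat_le_iff {n : ℕ} (x : Fin n → ℝ) {k : ℕ} (hk : 1 ≤ k) (hkn : k ≤ n) (c : ℝ) :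
    orderStat x k ≤ c ↔ k ≤ (Finset.univ.filter fun i => x i ≤ c).card := by
  have h : k - 1 < n := by omega
  rw [orderStat, dif_pos h, ← card_filter_sort x (· ≤ c)]
  have := Tuple.lt_card_le_iff_apply_le_of_monotone (j := ⟨k - 1, h⟩) (a := c)
    (Tuple.monotone_sort x)
  simp only [Function.comp_apply] at this ⊢
  rw [← this]
  omega

theorem orderStat_lt_iff {n : ℕ} (x : Fin n → ℝ) {k : ℕ} (hk : 1 ≤ k) (hkn : k ≤ n) (c : ℝ) :
    orderStat x k < c ↔ k ≤ (Finset.univ.filter fun i => x i < c).card := by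
  have h : k - 1 < n := by omega
  rw [orderStat, dif_pos h, ← card_filter_sort x (· < c)]
  have := Tuple.lt_card_lt_iff_apply_lt_of_monotone (j := ⟨k - 1, h⟩) (a := c)
    (Tuple.monotone_sort x)
  simp only [Function.comp_apply] at this ⊢
  rw [← this]
  omega

theorem orderStat_succ {n : ℕ} (x : Fin n → ℝ) {k : ℕ} (hk : k < n) :
    orderStat x (k + 1) = x (Tuple.sort x ⟨k, hk⟩) := by
  rw [orderStat, dif_pos (by simpa using hk)]
  rfl

theorem orderStat_mono {n : ℕ} (x : Fin n → ℝ) {k l : ℕ} (hk : 1 ≤ k) (hkl : k ≤ l) (hl : l ≤ n) :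
    orderStat x k ≤ orderStat x l := by
  rw [orderStat, orderStat, dif_pos (by omega), dif_pos (by omega)]
  apply Tuple.monotone_sort x
  simp only [Fin.mk_le_mk]
  omega

theorem measurable_orderStat {n k : ℕ} (hk : 1 ≤ k) (hkn : k ≤ n) :
    Measurable fun x : Fin n → ℝ => orderStat x k := by
  refine measurable_of_Iic fun c => ?_
  have : (fun x : Fin n → ℝ => orderStat x k) ⁻¹' Set.Iic c =
      {x | k ≤ ∑ i, if x i ≤ c then 1 else 0} := by
    ext x
    simp only [Set.mem_preimage, Set.mem_Iic, Set.mem_ofPred_eq, orderStat_le_iff x hk hkn,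
      Finset.card_filter]
  rw [this]
  refine measurableSet_le measurable_const (Finset.measurable_sum _ fun i _ => ?_)
  exact Measurable.ite (measurableSet_le (measurable_pi_apply i) measurable_const)
    measurable_const measurable_const

theorem abs_median_sub_le {n : ℕ} (x : Fin n → ℝ) (m s : ℝ)
    (h : 2 * (Finset.univ.filter fun i => s < |x i - m|).card < n) : |median x - m| ≤ s := by
  set bad := Finset.univ.filter fun i => s < |x i - m| with hbad
  have hc : (Finset.univ.filter fun i => ¬ s < |x i - m|).card + bad.card = n := by
    rw [add_comm, hbad, Finset.card_filter_add_card_filter_not]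
    simp
  have up : ∀ k, 1 ≤ k → k ≤ n / 2 + 1 → k ≤ n → orderStat x k ≤ m + s := by
    intro k h1 h2 h3
    rw [orderStat_le_iff x h1 h3]
    have : (Finset.univ.filter fun i => ¬ s < |x i - m|).card ≤
        (Finset.univ.filter fun i => x i ≤ m + s).card := by
      refine Finset.card_le_card fun i hi => ?_
      simp only [Finset.mem_filter, Finset.mem_univ, true_and, not_lt, abs_le] at hi ⊢
      linarith [hi.2]
    omega
  have lo : ∀ k, 1 ≤ k → (n + 1) / 2 ≤ k → k ≤ n → m - s ≤ orderStat x k := by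
    intro k h1 h2 h3
    by_contra! hlt
    rw [orderStat_lt_iff x h1 h3] at hlt
    have : (Finset.univ.filter fun i => x i < m - s).card ≤ bad.card := by
      refine Finset.card_le_card fun i hi => ?_
      simp only [hbad, Finset.mem_filter, Finset.mem_univ, true_and, lt_abs] at hi ⊢
      right
      linarith
    omega
  have u1 := up ((n + 1) / 2) (by omega) (by omega) (by omega)
  have u2 := up (n / 2 + 1) (by omega) (by omega) (by omega)
  have l1 := lo ((n + 1) / 2) (by omega) (by omega) (by omega)
  have l2 := lo (n / 2 + 1) (by omega) (by omega) (by omega)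
  rw [median, abs_le]
  constructor <;> linarith

/-! ### Importance ratios and divergences -/

namespace Env

variable {𝒳 : Type*} [MeasurableSpace 𝒳] {K N : ℕ} (E : Env 𝒳 K N)

instance : IsProbabilityMeasure E.nature := E.isProb

instance (i : Fin N) : IsMarkovKernel (E.expert i) := E.isMarkov i

instance (k : Fin N) : IsProbabilityMeasure (E.joint k) := by
  unfold joint; infer_instance

theorem measurable_prob (i : Fin N) : Measurable fun q : Fin K × 𝒳 => E.prob i q.1 q.2 :=
  measurable_from_prod_countable_right fun v =>
    ((E.expert i).measurable_coe (measurableSet_singleton v)).ennreal_toReal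

theorem measurable_ratio (i j : Fin N) :
    Measurable fun z : (𝒳 × (Fin K → ℝ)) × Fin K => E.ratio i j z.2 z.1.1 := by
  have h : Measurable fun z : (𝒳 × (Fin K → ℝ)) × Fin K => (z.2, z.1.1) := by fun_prop
  exact ((E.measurable_prob i).comp h).div ((E.measurable_prob j).comp h)

theorem prob_nonneg (i : Fin N) (v : Fin K) (x : 𝒳) : 0 ≤ E.prob i v x := measureReal_nonneg

theorem ratio_nonneg (i j : Fin N) (v : Fin K) (x : 𝒳) : 0 ≤ E.ratio i j v x :=
  div_nonneg (E.prob_nonneg i v x) (E.prob_nonneg j v x)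

/-- The observed reward. -/
def obs (z : (𝒳 × (Fin K → ℝ)) × Fin K) : ℝ := z.1.2 z.2

theorem measurable_obs : Measurable (obs : (𝒳 × (Fin K → ℝ)) × Fin K → ℝ) :=
  measurable_from_prod_countable_left fun v => (measurable_pi_apply v).comp measurable_snd

theorem lintegral_joint (k : Fin N) {f : (𝒳 × (Fin K → ℝ)) × Fin K → ℝ≥0∞} (hf : Measurable f) :
    ∫⁻ z, f z ∂(E.joint k) =
      ∫⁻ z, ∑ v, ENNReal.ofReal (E.prob k v z.1) * f (z, v) ∂E.nature := by
  rw [joint, Measure.lintegral_compProd hf]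
  refine lintegral_congr fun z => ?_
  rw [lintegral_fintype]
  refine Finset.sum_congr rfl fun v _ => ?_
  rw [mul_comm, Kernel.comap_apply, prob, ofReal_measureReal]

theorem ae_obs_mem (k : Fin N) : ∀ᵐ z ∂(E.joint k), obs z ∈ Set.Icc (0 : ℝ) 1 := by
  have hm : MeasurableSet {z : (𝒳 × (Fin K → ℝ)) × Fin K | obs z ∈ Set.Icc (0 : ℝ) 1} :=
    measurable_obs measurableSet_Icc
  rw [joint, Measure.ae_compProd_iff hm]
  filter_upwards [E.reward_mem] with z hz
  exact Filter.Eventually.of_forall fun v => hz v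

theorem joint_eq_withDensity {i j : Fin N}
    (hac : ∀ᵐ z ∂E.nature, E.expert i z.1 ≪ E.expert j z.1) :
    E.joint i = (E.joint j).withDensity fun z => ENNReal.ofReal (E.ratio i j z.2 z.1.1) := by
  ext B hB
  rw [withDensity_apply _ hB, ← lintegral_indicator hB, ← lintegral_indicator_one hB,
    E.lintegral_joint i (measurable_one.indicator hB),
    E.lintegral_joint j ((E.measurable_ratio i j).ennreal_ofReal.indicator hB)]
  refine lintegral_congr_ae ?_
  filter_upwards [hac] with z hz
  refine Finset.sum_congr rfl fun v _ => ?_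
  by_cases hv : (z, v) ∈ B
  · simp only [hv, Set.indicator_of_mem, Pi.one_apply, mul_one]
    rw [← ENNReal.ofReal_mul (E.prob_nonneg j v z.1), ratio]
    by_cases h0 : E.prob j v z.1 = 0
    · have : E.expert j z.1 {v} = 0 := by
        simpa [prob, measureReal_def, ENNReal.toReal_eq_zero_iff] using h0
      simp [prob, measureReal_def, hz this]
    · rw [mul_div_cancel₀ _ h0]
  · simp [hv]

theorem integral_ratio_mul {i j : Fin N} (hac : ∀ᵐ z ∂E.nature, E.expert i z.1 ≪ E.expert j z.1)
    (f : (𝒳 × (Fin K → ℝ)) × Fin K → ℝ) :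
    ∫ z, E.ratio i j z.2 z.1.1 * f z ∂(E.joint j) = ∫ z, f z ∂(E.joint i) := by
  rw [E.joint_eq_withDensity hac, integral_withDensity_eq_integral_toReal_smul
    (E.measurable_ratio i j).ennreal_ofReal (by simp)]
  simp [ENNReal.toReal_ofReal (E.ratio_nonneg _ _ _ _)]

theorem integrable_ratio_mul {i j : Fin N}
    (hac : ∀ᵐ z ∂E.nature, E.expert i z.1 ≪ E.expert j z.1)
    {f : (𝒳 × (Fin K → ℝ)) × Fin K → ℝ} (hf : Integrable f (E.joint i)) :
    Integrable (fun z => E.ratio i j z.2 z.1.1 * f z) (E.joint j) := by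
  rw [E.joint_eq_withDensity hac, integrable_withDensity_iff_integrable_smul'
    (E.measurable_ratio i j).ennreal_ofReal (by simp)] at hf
  simpa [ENNReal.toReal_ofReal (E.ratio_nonneg _ _ _ _)] using hf

theorem integrable_ratio {i j : Fin N} (hac : ∀ᵐ z ∂E.nature, E.expert i z.1 ≪ E.expert j z.1) :
    Integrable (fun z => E.ratio i j z.2 z.1.1) (E.joint j) := by
  simpa using E.integrable_ratio_mul hac (integrable_const (1 : ℝ))

theorem integral_ratio {i j : Fin N} (hac : ∀ᵐ z ∂E.nature, E.expert i z.1 ≪ E.expert j z.1) :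
    ∫ z, E.ratio i j z.2 z.1.1 ∂(E.joint j) = 1 := by
  simpa using E.integral_ratio_mul hac fun _ => (1 : ℝ)

theorem integrable_obs (k : Fin N) : Integrable obs (E.joint k) :=
  Integrable.of_mem_Icc 0 1 measurable_obs.aemeasurable (E.ae_obs_mem k)

theorem mean_eq (k : Fin N) : E.mean k = ∫ z, obs z ∂(E.joint k) := rfl

theorem mean_mem (k : Fin N) : E.mean k ∈ Set.Icc (0 : ℝ) 1 := by
  rw [mean_eq]
  constructor
  · exact integral_nonneg_of_ae ((E.ae_obs_mem k).mono fun z hz => hz.1)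
  · calc ∫ z, obs z ∂(E.joint k) ≤ ∫ _, (1 : ℝ) ∂(E.joint k) :=
          integral_mono_ae (E.integrable_obs k) (integrable_const _)
            ((E.ae_obs_mem k).mono fun z hz => hz.2)
      _ = 1 := by simp

theorem mean_le_bestMean (k : Fin N) : E.mean k ≤ E.bestMean :=
  le_ciSup (Set.finite_range _).bddAbove k

theorem gap_nonneg (k : Fin N) : 0 ≤ E.gap k := sub_nonneg.2 (E.mean_le_bestMean k)

theorem exists_gap_eq_zero (hN : 0 < N) : ∃ k, E.gap k = 0 := by
  have : Nonempty (Fin N) := ⟨⟨0, hN⟩⟩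
  obtain ⟨k, hk⟩ := exists_eq_ciSup_of_finite (f := E.mean)
  exact ⟨k, by rw [gap, bestMean, hk, sub_self]⟩

theorem gap_le_one (k : Fin N) : E.gap k ≤ 1 := by
  have : Nonempty (Fin N) := ⟨k⟩
  have h : E.bestMean ≤ 1 := ciSup_le fun i => (E.mean_mem i).2
  have := (E.mean_mem k).1
  unfold gap
  linarith

theorem gap_eq_zero_or_le (k : Fin N) (hN : 2 ≤ N) : E.gap k = 0 ∨ E.sortedGap 2 ≤ E.gap k := by
  by_contra! h
  obtain ⟨h0, h2⟩ := h
  obtain ⟨b, hb⟩ := E.exists_gap_eq_zero (by omega)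
  have hbk : b ≠ k := fun e => h0 (e ▸ hb)
  have hpos := lt_of_le_of_ne (E.gap_nonneg k) (Ne.symm h0)
  refine absurd h2 (not_lt.2 ?_)
  unfold sortedGap
  rw [orderStat_le_iff _ (by norm_num) hN, ← Finset.card_pair hbk]
  refine Finset.card_le_card fun i hi => ?_
  simp only [Finset.mem_insert, Finset.mem_singleton] at hi
  rcases hi with rfl | rfl <;> simp [hb, hpos.le]

theorem condDiv_nonneg_of_two_mul_sub_one_le {i j : Fin N} {f : ℝ → ℝ}
    (hf : ∀ x, 0 ≤ x → 2 * (x - 1) ≤ f x)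
    (h : E.FiniteDiv f i j) : 0 ≤ E.condDiv f i j := by
  have h1 : ∫ z, 2 * (E.ratio i j z.2 z.1.1 - 1) ∂(E.joint j) ≤ E.condDiv f i j :=
    integral_mono (((E.integrable_ratio h.1).sub (integrable_const _)).const_mul _) h.2
      fun z => hf _ (E.ratio_nonneg _ _ _ _)
  rw [integral_const_mul, integral_sub (E.integrable_ratio h.1) (integrable_const _),
    E.integral_ratio h.1] at h1
  simpa using h1

theorem condDiv_fLog_nonneg {i j : Fin N} (h : E.FiniteDiv fLog i j) :
    0 ≤ E.condDiv fLog i j := by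
  refine E.condDiv_nonneg_of_two_mul_sub_one_le (fun x hx => ?_) h
  have := Real.add_one_le_exp (x - 1)
  unfold fLog
  nlinarith [sq_nonneg (x - 1)]

theorem condDiv_fChi_nonneg {i j : Fin N} (h : E.FiniteDiv fChi i j) :
    0 ≤ E.condDiv fChi i j := by
  refine E.condDiv_nonneg_of_two_mul_sub_one_le (fun x hx => ?_) h
  unfold fChi
  nlinarith [sq_nonneg (x - 1)]

theorem one_le_logDiv {i j : Fin N} (h : E.FiniteDiv fLog i j) : 1 ≤ E.logDiv i j := by
  have := Real.log_nonneg (by linarith [E.condDiv_fLog_nonneg h] : 1 ≤ 1 + E.condDiv fLog i j)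
  unfold logDiv
  linarith

theorem logDiv_le_logDivMax (i j : Fin N) : E.logDiv i j ≤ E.logDivMax :=
  le_ciSup (f := fun p : Fin N × Fin N => E.logDiv p.1 p.2) (Set.finite_range _).bddAbove (i, j)

theorem one_le_chiDiv {i j : Fin N} (h : E.FiniteDiv fChi i j) : 1 ≤ E.chiDiv i j := by
  unfold chiDiv
  rw [Real.one_le_sqrt]
  linarith [E.condDiv_fChi_nonneg h]

theorem chiDiv_le_chiDivMax (i j : Fin N) : E.chiDiv i j ≤ E.chiDivMax :=
  le_ciSup (f := fun p : Fin N × Fin N => E.chiDiv p.1 p.2) (Set.finite_range _).bddAbove (i, j)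

theorem integrable_ratio_sq {i j : Fin N} (h : E.FiniteDiv fChi i j) :
    Integrable (fun z => E.ratio i j z.2 z.1.1 ^ 2) (E.joint j) := by
  have := h.2.add (integrable_const (1 : ℝ))
  refine this.congr (Filter.Eventually.of_forall fun z => ?_)
  simp [fChi]

theorem integral_ratio_sq {i j : Fin N} (h : E.FiniteDiv fChi i j) :
    ∫ z, E.ratio i j z.2 z.1.1 ^ 2 ∂(E.joint j) = E.chiDiv i j ^ 2 := by
  rw [chiDiv, Real.sq_sqrt (by linarith [E.condDiv_fChi_nonneg h]), condDiv]
  simp only [fChi]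
  rw [integral_sub (E.integrable_ratio_sq h) (integrable_const _)]
  simp

theorem integrable_ratio_mul_exp {i j : Fin N} (h : E.FiniteDiv fLog i j) :
    Integrable (fun z => E.ratio i j z.2 z.1.1 * Real.exp (E.ratio i j z.2 z.1.1 - 1))
      (E.joint j) := by
  have := h.2.add (integrable_const (1 : ℝ))
  refine this.congr (Filter.Eventually.of_forall fun z => ?_)
  simp [fLog]

theorem integral_ratio_mul_exp {i j : Fin N} (h : E.FiniteDiv fLog i j) :
    ∫ z, E.ratio i j z.2 z.1.1 * Real.exp (E.ratio i j z.2 z.1.1 - 1) ∂(E.joint j) =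
      Real.exp (E.logDiv i j - 1) := by
  rw [logDiv, add_sub_cancel_left, Real.exp_log (by linarith [E.condDiv_fLog_nonneg h]), condDiv]
  simp only [fLog]
  rw [integral_sub (E.integrable_ratio_mul_exp h) (integrable_const _)]
  simp

/-- The law of a step as a kernel from the selected expert and a further parameter. -/
noncomputable def stepKernel (S : Type*) [MeasurableSpace S] :
    Kernel (Fin N × S) ((𝒳 × (Fin K → ℝ)) × Fin K) where
  toFun q := E.joint q.1
  measurable' := (measurable_of_countable E.joint).comp measurable_fst

instance (S : Type*) [MeasurableSpace S] : IsMarkovKernel (E.stepKernel S) :=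
  ⟨fun q => inferInstanceAs (IsProbabilityMeasure (E.joint q.1))⟩

end Env

/-! ### The conditional law of a step -/

/-- Disintegration of an expectation along a random element `φ` of a measurable space and a random
element `ξ` whose conditional law given `φ` is `κ`. -/
theorem lintegral_of_step {Ω S Z : Type*} [MeasurableSpace Ω] [MeasurableSpace S]
    [MeasurableSpace Z] (P : Measure Ω) [IsProbabilityMeasure P] (κ : Kernel S Z)
    [IsMarkovKernel κ] {φ : Ω → S} {ξ : Ω → Z} (hφ : Measurable φ) (hξ : Measurable ξ)
    (h : ∀ A, MeasurableSet A → ∀ B, MeasurableSet B →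
      P (φ ⁻¹' A ∩ ξ ⁻¹' B) = ∫⁻ ω in φ ⁻¹' A, κ (φ ω) B ∂P)
    {F : S × Z → ℝ≥0∞} (hF : Measurable F) :
    ∫⁻ ω, F (φ ω, ξ ω) ∂P = ∫⁻ ω, ∫⁻ z, F (φ ω, z) ∂(κ (φ ω)) ∂P := by
  have := Measure.isProbabilityMeasure_map (μ := P) hφ.aemeasurable
  have key : P.map (fun ω => (φ ω, ξ ω)) = (P.map φ) ⊗ₘ κ := by
    have := Measure.isProbabilityMeasure_map (μ := P) (hφ.prodMk hξ).aemeasurable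
    refine Measure.ext_prod fun {A B} hA hB => ?_
    rw [Measure.map_apply (hφ.prodMk hξ) (hA.prod hB), Measure.compProd_apply_prod hA hB,
      setLIntegral_map hA (κ.measurable_coe hB) hφ, ← h A hA B hB]
    rfl
  rw [← lintegral_map hF (hφ.prodMk hξ), key, Measure.lintegral_compProd hF,
    lintegral_map hF.lintegral_kernel_prod_right' hφ]

namespace Run

variable {𝒳 : Type*} [MeasurableSpace 𝒳] {K N : ℕ} {E : Env 𝒳 K N}
  {Ω : Type*} [mΩ : MeasurableSpace Ω] (run : Run E Ω)

instance : IsProbabilityMeasure run.law := run.isProb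

/-- What happens at time `t`: the context, the rewards and the arm. -/
def step (t : ℕ) (ω : Ω) : (𝒳 × (Fin K → ℝ)) × Fin K :=
  ((run.ctx t ω, run.rewards t ω), run.arm t ω)

theorem measurable_step_filtration (t : ℕ) : Measurable[run.ℱ (t + 1)] (run.step (t + 1)) :=
  ((run.ctx_meas t).prodMk (run.rewards_meas t)).prodMk (run.arm_meas t)

theorem measurable_step (t : ℕ) : Measurable (run.step (t + 1)) :=
  (run.measurable_step_filtration t).mono (run.ℱ.le _) le_rfl

theorem measurable_expert (t : ℕ) : Measurable (run.expert (t + 1)) :=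
  (run.expert_meas t).mono (run.ℱ.le _) le_rfl

theorem lintegral_step {S : Type*} [MeasurableSpace S] (t : ℕ) {φ : Ω → S}
    (hφ : Measurable[run.ℱ t] φ)
    {F : Fin N × S → (𝒳 × (Fin K → ℝ)) × Fin K → ℝ≥0∞} (hF : Measurable (Function.uncurry F)) :
    ∫⁻ ω, F (run.expert (t + 1) ω, φ ω) (run.step (t + 1) ω) ∂run.law =
      ∫⁻ ω, ∫⁻ z, F (run.expert (t + 1) ω, φ ω) z ∂(E.joint (run.expert (t + 1) ω)) ∂run.law := by
  have hm : Measurable[run.ℱ t] fun ω => (run.expert (t + 1) ω, φ ω) :=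
    (run.expert_meas t).prodMk hφ
  refine lintegral_of_step run.law (E.stepKernel S) (φ := fun ω => (run.expert (t + 1) ω, φ ω))
    (hm.mono (run.ℱ.le _) le_rfl) (run.measurable_step t) (fun A hA B hB => ?_) hF
  exact run.step_law t _ (hm hA) B hB

theorem ae_step (t : ℕ) {q : (𝒳 × (Fin K → ℝ)) × Fin K → Prop}
    (hq : MeasurableSet {z | q z}) (h : ∀ j, ∀ᵐ z ∂(E.joint j), q z) :
    ∀ᵐ ω ∂run.law, q (run.step (t + 1) ω) := by
  have := run.step_law t Set.univ MeasurableSet.univ {z | ¬ q z} hq.compl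
  rw [Set.univ_inter, Measure.restrict_univ] at this
  rw [ae_iff]
  refine this.trans ?_
  simp only [fun j => ae_iff.1 (h j), lintegral_zero]

theorem ae_obs_step_mem :
    ∀ᵐ ω ∂run.law, ∀ s, Env.obs (run.step (s + 1) ω) ∈ Set.Icc (0 : ℝ) 1 :=
  ae_all_iff.2 fun s => run.ae_step s (q := fun z => Env.obs z ∈ Set.Icc (0 : ℝ) 1)
    (Env.measurable_obs measurableSet_Icc) E.ae_obs_mem

end Run

end StochasticExperts

namespace StochasticExperts

open scoped ENNReal NNReal

/-! ### From bad events to the regret -/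

theorem sum_range_one_div_sq_le (n : ℕ) :
    ∑ t ∈ Finset.range n, 1 / (t : ℝ) ^ 2 ≤ 2 := by
  have key : ∀ n : ℕ, ∑ t ∈ Finset.range (n + 2), 1 / (t : ℝ) ^ 2 ≤ 2 - 1 / ((n : ℝ) + 1) := by
    intro n
    induction n with
    | zero => norm_num [Finset.sum_range_succ]
    | succ n ih =>
      rw [Finset.sum_range_succ]
      have : 1 / ((n + 2 : ℕ) : ℝ) ^ 2 ≤ 1 / ((n : ℝ) + 1) - 1 / (((n + 1 : ℕ) : ℝ) + 1) := by
        push_cast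
        rw [div_sub_div _ _ (by positivity) (by positivity), div_le_div_iff₀ (by positivity)
          (by positivity)]
        nlinarith
      linarith
  calc ∑ t ∈ Finset.range n, 1 / (t : ℝ) ^ 2
      ≤ ∑ t ∈ Finset.range (n + 2), 1 / (t : ℝ) ^ 2 :=
        Finset.sum_le_sum_of_subset_of_nonneg (Finset.range_subset_range.2 (by omega))
          fun _ _ _ => by positivity
    _ ≤ 2 := (key n).trans (by simp; positivity)

theorem sum_range_one_div_sqrt_le (n : ℕ) :
    ∑ t ∈ Finset.range (n + 1), 1 / Real.sqrt t ≤ 2 * Real.sqrt n := by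
  induction n with
  | zero => simp
  | succ n ih =>
    rw [Finset.sum_range_succ]
    have h0 : 0 < Real.sqrt ((n + 1 : ℕ) : ℝ) := Real.sqrt_pos.2 (by positivity)
    have h1 := Real.sq_sqrt (Nat.cast_nonneg (α := ℝ) (n + 1))
    have h2 := Real.sq_sqrt (Nat.cast_nonneg (α := ℝ) n)
    have : 1 / Real.sqrt ((n + 1 : ℕ) : ℝ) ≤
        2 * Real.sqrt ((n + 1 : ℕ) : ℝ) - 2 * Real.sqrt n := by
      rw [div_le_iff₀ h0]
      push_cast at *
      nlinarith [sq_nonneg (Real.sqrt ((n : ℝ) + 1) - Real.sqrt n)]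
    linarith

theorem sum_range_sqrt_div_le {A d : ℝ} (hA : 0 ≤ A) (hd : 0 < d) (T : ℕ) :
    ∑ t ∈ Finset.range T, (if d ≤ Real.sqrt (A / t) then Real.sqrt (A / t) else 0) ≤
      2 * A / d := by
  set n := ⌊A / d ^ 2⌋₊
  rw [← Finset.sum_filter]
  calc ∑ t ∈ (Finset.range T).filter (fun t : ℕ => d ≤ Real.sqrt (A / t)), Real.sqrt (A / t)
      ≤ ∑ t ∈ Finset.range (n + 1), Real.sqrt (A / t) := by
        refine Finset.sum_le_sum_of_subset_of_nonneg (fun t ht => ?_) fun _ _ _ => by positivity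
        rw [Finset.mem_filter] at ht
        rw [Finset.mem_range, Nat.lt_succ_iff]
        apply Nat.le_floor
        rw [Real.le_sqrt' hd] at ht
        rcases Nat.eq_zero_or_pos t with rfl | h0
        · simpa using by positivity
        · have h0 : (0 : ℝ) < t := by exact_mod_cast h0
          rw [le_div_iff₀ (by positivity)]
          rw [le_div_iff₀ h0] at ht
          linarith [ht.2]
    _ = Real.sqrt A * ∑ t ∈ Finset.range (n + 1), 1 / Real.sqrt t := by
        rw [Finset.mul_sum]
        exact Finset.sum_congr rfl fun t _ => by rw [Real.sqrt_div hA, mul_one_div]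
    _ ≤ Real.sqrt A * (2 * (Real.sqrt A / d)) := by
        refine mul_le_mul_of_nonneg_left ((sum_range_one_div_sqrt_le n).trans ?_) (by positivity)
        have : Real.sqrt n ≤ Real.sqrt (A / d ^ 2) :=
          Real.sqrt_le_sqrt (Nat.floor_le (by positivity))
        rw [Real.sqrt_div hA, Real.sqrt_sq hd.le] at this
        linarith
    _ = 2 * (Real.sqrt A * Real.sqrt A) / d := by ring
    _ = 2 * A / d := by rw [Real.mul_self_sqrt hA]

theorem sum_Icc_one {M : Type*} [AddCommMonoid M] (f : ℕ → M) (t : ℕ) :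
    ∑ s ∈ Finset.Icc 1 t, f s = ∑ s ∈ Finset.range t, f (s + 1) := by
  rw [Finset.range_eq_Ico, Finset.sum_Ico_add' f 0 t 1]
  rfl

theorem sum_times {N : ℕ} {M : Type*} [AddCommMonoid M] (h : ℕ → Fin N) (t : ℕ)
    (f : Fin N → ℕ → M) :
    ∑ j, ∑ s ∈ times h j t, f j s = ∑ s ∈ Finset.range t, f (h (s + 1)) (s + 1) := by
  rw [← sum_Icc_one fun s => f (h s) s, ← Finset.sum_fiberwise (Finset.Icc 1 t) h]
  refine Finset.sum_congr rfl fun j _ => Finset.sum_congr rfl fun s hs => ?_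
  rw [(Finset.mem_filter.1 hs).2]

namespace Run

variable {𝒳 : Type*} [MeasurableSpace 𝒳] {K N : ℕ} {E : Env 𝒳 K N}
  {Ω : Type*} [mΩ : MeasurableSpace Ω] (run : Run E Ω)

theorem regret_le (hN : 2 ≤ N) {d A c : ℝ} (hd : 0 < d) (hgap : E.sortedGap 2 = d) (hA : 0 ≤ A)
    (hc : 0 ≤ c) (t₀ T : ℕ)
    (h : ∀ t, t₀ ≤ t → t < T → ∃ B : Set Ω, run.law B ≤ ENNReal.ofReal (c * (1 / (t : ℝ) ^ 2)) ∧
      ∀ᵐ ω ∂run.law, ω ∉ B → E.gap (run.expert (t + 1) ω) ≤ Real.sqrt (A / t)) :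
    run.regret T ≤ t₀ + 2 * c + 2 * A / d := by
  have hint : ∀ t, Integrable (fun ω => E.gap (run.expert (t + 1) ω)) run.law := fun t =>
    Integrable.of_mem_Icc 0 1
      ((measurable_of_countable E.gap).comp (run.measurable_expert t)).aemeasurable
      (Filter.Eventually.of_forall fun ω => ⟨E.gap_nonneg _, E.gap_le_one _⟩)
  set g : ℕ → ℝ := fun t => if d ≤ Real.sqrt (A / t) then Real.sqrt (A / t) else 0 with hg
  have hg0 : ∀ t, 0 ≤ g t := fun t => by simp only [hg]; split_ifs <;> positivity
  have hterm : ∀ t < T, ∫ ω, E.gap (run.expert (t + 1) ω) ∂run.law ≤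
      (if t < t₀ then 1 else 0) + c * (1 / (t : ℝ) ^ 2) + g t := by
    intro t ht
    by_cases htt : t < t₀
    · rw [if_pos htt]
      have : ∫ ω, E.gap (run.expert (t + 1) ω) ∂run.law ≤ ∫ _, (1 : ℝ) ∂run.law :=
        integral_mono (hint t) (integrable_const _) fun ω => E.gap_le_one _
      simp only [integral_const, probReal_univ, smul_eq_mul, mul_one] at this
      have : 0 ≤ c * (1 / (t : ℝ) ^ 2) := by positivity
      linarith [hg0 t]
    · obtain ⟨B, hB, hgood⟩ := h t (not_lt.1 htt) ht
      have hm := measurableSet_toMeasurable run.law B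
      calc ∫ ω, E.gap (run.expert (t + 1) ω) ∂run.law
          ≤ ∫ ω, ((toMeasurable run.law B).indicator (fun _ => (1 : ℝ)) ω + g t) ∂run.law := by
            refine integral_mono_ae (hint t)
              (((integrable_const (1 : ℝ)).indicator hm).add (integrable_const _)) ?_
            filter_upwards [hgood] with ω hω
            by_cases hωB : ω ∈ toMeasurable run.law B
            · simp only [Set.indicator_of_mem hωB]
              linarith [E.gap_le_one (run.expert (t + 1) ω), hg0 t]
            · simp only [Set.indicator_of_notMem hωB, zero_add]
              have h1 := hω fun hω => hωB (subset_toMeasurable _ _ hω)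
              rcases E.gap_eq_zero_or_le (run.expert (t + 1) ω) hN with h0 | h0
              · rw [h0]
                exact hg0 t
              · rw [hgap] at h0
                simp only [hg]
                rwa [if_pos (h0.trans h1)]
        _ = run.law.real B + g t := by
            rw [integral_add ((integrable_const (1 : ℝ)).indicator hm) (integrable_const _),
              integral_indicator_const _ hm]
            simp [measureReal_def]
        _ ≤ _ := by
            have : run.law.real B ≤ c * (1 / (t : ℝ) ^ 2) :=
              ENNReal.toReal_le_of_le_ofReal (by positivity) hB
            rw [if_neg htt]
            linarith
  calc run.regret T = ∑ t ∈ Finset.range T, ∫ ω, E.gap (run.expert (t + 1) ω) ∂run.law := by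
        rw [regret, ← integral_finsetSum _ fun t _ => hint t]
        simp only [sum_Icc_one]
        rfl
    _ ≤ ∑ t ∈ Finset.range T, ((if t < t₀ then 1 else 0) + c * (1 / (t : ℝ) ^ 2) + g t) :=
        Finset.sum_le_sum fun t ht => hterm t (Finset.mem_range.1 ht)
    _ ≤ t₀ + c * 2 + 2 * A / d := by
        rw [Finset.sum_add_distrib, Finset.sum_add_distrib, ← Finset.mul_sum]
        refine add_le_add (add_le_add ?_
          (mul_le_mul_of_nonneg_left (sum_range_one_div_sq_le T) hc))
          (sum_range_sqrt_div_le hA hd T)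
        rw [← Finset.sum_filter, Finset.sum_const, nsmul_one]
        have : (Finset.range T).filter (· < t₀) ⊆ Finset.range t₀ := fun t ht => by
          simpa using (Finset.mem_filter.1 ht).2
        exact_mod_cast (Finset.card_le_card this).trans (Finset.card_range t₀).le
    _ = _ := by ring

/-! ### Concentration of sums along a run -/

theorem measurable_sum_step {f : Fin N → (𝒳 × (Fin K → ℝ)) × Fin K → ℝ}
    (hf : ∀ j, Measurable (f j)) (t : ℕ) :
    Measurable[run.ℱ t] fun ω =>
      ∑ s ∈ Finset.range t, f (run.expert (s + 1) ω) (run.step (s + 1) ω) := by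
  refine Finset.measurable_fun_sum _ fun s hs => ?_
  have hs := Finset.mem_range.1 hs
  have h1 : Measurable[run.ℱ t] fun ω => (run.expert (s + 1) ω, run.step (s + 1) ω) :=
    ((run.expert_meas s).mono (run.ℱ.mono hs.le) le_rfl).prodMk
      ((run.measurable_step_filtration s).mono (run.ℱ.mono hs) le_rfl)
  exact (measurable_from_prod_countable_right hf :
    Measurable fun q : Fin N × ((𝒳 × (Fin K → ℝ)) × Fin K) => f q.1 q.2).comp h1

theorem lintegral_exp_sum_le {f : Fin N → (𝒳 × (Fin K → ℝ)) × Fin K → ℝ}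
    (hf : ∀ j, Measurable (f j)) {B : ℝ≥0∞}
    (hB : ∀ j, ∫⁻ z, ENNReal.ofReal (Real.exp (f j z)) ∂(E.joint j) ≤ B) (t : ℕ) :
    ∫⁻ ω, ENNReal.ofReal (Real.exp (∑ s ∈ Finset.range t,
      f (run.expert (s + 1) ω) (run.step (s + 1) ω))) ∂run.law ≤ B ^ t := by
  induction t with
  | zero => simp
  | succ t ih =>
    have hfm : Measurable fun q : Fin N × ((𝒳 × (Fin K → ℝ)) × Fin K) => f q.1 q.2 :=
      measurable_from_prod_countable_right hf
    have hF : Measurable (Function.uncurry fun (q : Fin N × ℝ) z =>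
        ENNReal.ofReal (Real.exp q.2) * ENNReal.ofReal (Real.exp (f q.1 z))) := by
      have : Measurable fun q : (Fin N × ℝ) × ((𝒳 × (Fin K → ℝ)) × Fin K) => (q.1.1, q.2) := by
        fun_prop
      exact (by fun_prop : Measurable fun q : (Fin N × ℝ) × ((𝒳 × (Fin K → ℝ)) × Fin K) =>
        ENNReal.ofReal (Real.exp q.1.2)).mul (hfm.comp this).exp.ennreal_ofReal
    have := run.lintegral_step t (run.measurable_sum_step hf t) hF
    simp only [Finset.sum_range_succ, Real.exp_add, ENNReal.ofReal_mul (Real.exp_nonneg _)]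
    rw [this]
    calc _ ≤ ∫⁻ ω, ENNReal.ofReal (Real.exp (∑ s ∈ Finset.range t,
          f (run.expert (s + 1) ω) (run.step (s + 1) ω))) * B ∂run.law := by
          refine lintegral_mono fun ω => ?_
          rw [lintegral_const_mul _ (hf _).exp.ennreal_ofReal]
          exact mul_le_mul_right (hB _) _
      _ ≤ B ^ t * B := by
          rw [lintegral_mul_const _ (((run.measurable_sum_step hf t).mono (run.ℱ.le t)
            le_rfl).exp.ennreal_ofReal)]
          exact mul_le_mul_left ih _
      _ = B ^ (t + 1) := (pow_succ _ _).symm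

/-- The Azuma–Hoeffding inequality along a run. -/
theorem measure_sum_ge_le {f : Fin N → (𝒳 × (Fin K → ℝ)) × Fin K → ℝ}
    (hf : ∀ j, Measurable (f j)) {c : ℝ≥0} (hc : 0 < c)
    (hsub : ∀ j, HasSubgaussianMGF (f j) c (E.joint j)) {t : ℕ} (ht : 0 < t) {x : ℝ}
    (hx : 0 ≤ x) :
    run.law {ω | x ≤ ∑ s ∈ Finset.range t, f (run.expert (s + 1) ω) (run.step (s + 1) ω)} ≤
      ENNReal.ofReal (Real.exp (-(x ^ 2 / (2 * t * c)))) := by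
  have ht' : (0 : ℝ) < t := by exact_mod_cast ht
  have hc' : (0 : ℝ) < c := by exact_mod_cast hc
  set l : ℝ := x / (t * c) with hl
  have hl0 : 0 ≤ l := by positivity
  have h1 := run.lintegral_exp_sum_le (f := fun j z => l * f j z) (fun j => (hf j).const_mul l)
    (B := ENNReal.ofReal (Real.exp (c * l ^ 2 / 2))) (fun j => by
      rw [← ofReal_integral_eq_lintegral_ofReal ((hsub j).integrable_exp_mul l)
        (Filter.Eventually.of_forall fun _ => Real.exp_nonneg _)]
      exact ENNReal.ofReal_le_ofReal ((hsub j).mgf_le l)) t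
  rw [← ENNReal.ofReal_pow (Real.exp_nonneg _), ← Real.exp_nat_mul] at h1
  simp only [← Finset.mul_sum] at h1
  have hS := (run.measurable_sum_step hf t).mono (run.ℱ.le t) le_rfl
  have h2 := meas_ge_le_lintegral_div (μ := run.law)
    (f := fun ω => ENNReal.ofReal (Real.exp (l * ∑ s ∈ Finset.range t,
      f (run.expert (s + 1) ω) (run.step (s + 1) ω))))
    (hS.const_mul l).exp.ennreal_ofReal.aemeasurable
    (ε := ENNReal.ofReal (Real.exp (l * x)))
    (by simp [Real.exp_pos]) ENNReal.ofReal_ne_top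
  calc _ ≤ _ := measure_mono fun ω hω => by
        have hω : x ≤ _ := hω
        exact ENNReal.ofReal_le_ofReal (Real.exp_le_exp.2 (mul_le_mul_of_nonneg_left hω hl0))
    _ ≤ _ := h2
    _ ≤ _ := ENNReal.div_le_div_right h1 _
    _ = ENNReal.ofReal (Real.exp (-(x ^ 2 / (2 * t * c)))) := by
        rw [← ENNReal.ofReal_div_of_pos (Real.exp_pos _), ← Real.exp_sub, hl]
        congr 2
        field_simp
        ring

end Run

end StochasticExperts

namespace StochasticExperts

open scoped ENNReal NNReal

/-! ### The clipped estimator -/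

namespace Env

variable {𝒳 : Type*} [MeasurableSpace 𝒳] {K N : ℕ} (E : Env 𝒳 K N)

open Classical in
/-- The weighted reward, importance weighted and clipped at the level `τ M_kj`. -/
noncomputable def clipTerm (k : Fin N) (τ : ℝ) (j : Fin N) (z : (𝒳 × (Fin K → ℝ)) × Fin K) : ℝ :=
  1 / E.logDiv k j * obs z * E.ratio k j z.2 z.1.1 *
    (if E.ratio k j z.2 z.1.1 ≤ τ * E.logDiv k j then 1 else 0)

theorem measurable_clipTerm (k : Fin N) (τ : ℝ) (j : Fin N) :
    Measurable (E.clipTerm k τ j) := by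
  have h := E.measurable_ratio k j
  exact ((measurable_const.mul measurable_obs).mul h).mul
    (Measurable.ite (measurableSet_le h measurable_const) measurable_const measurable_const)

theorem clipTerm_mono {k j : Fin N} (hM : 0 < E.logDiv k j) {z : (𝒳 × (Fin K → ℝ)) × Fin K}
    (hz : 0 ≤ obs z) {τ τ' : ℝ} (h : τ ≤ τ') : E.clipTerm k τ j z ≤ E.clipTerm k τ' j z := by
  have hr := E.ratio_nonneg k j z.2 z.1.1
  unfold clipTerm
  refine mul_le_mul_of_nonneg_left ?_ (by positivity)
  have : τ * E.logDiv k j ≤ τ' * E.logDiv k j := mul_le_mul_of_nonneg_right h hM.le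
  split_ifs with h1 h2
  · exact le_rfl
  · exact absurd (h1.trans this) h2
  · exact zero_le_one
  · exact le_rfl

theorem clipTerm_nonneg {k j : Fin N} (hM : 0 < E.logDiv k j) {z : (𝒳 × (Fin K → ℝ)) × Fin K}
    (hz : 0 ≤ obs z) (τ : ℝ) : 0 ≤ E.clipTerm k τ j z := by
  have hr := E.ratio_nonneg k j z.2 z.1.1
  unfold clipTerm
  split_ifs <;> positivity

theorem clipTerm_le {k j : Fin N} (hM : 0 < E.logDiv k j) {z : (𝒳 × (Fin K → ℝ)) × Fin K}
    (hz : obs z ∈ Set.Icc (0 : ℝ) 1) {τ : ℝ} (hτ : 0 ≤ τ) : E.clipTerm k τ j z ≤ τ := by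
  have hr := E.ratio_nonneg k j z.2 z.1.1
  unfold clipTerm
  split_ifs with h
  · calc 1 / E.logDiv k j * obs z * E.ratio k j z.2 z.1.1 * 1
        ≤ 1 / E.logDiv k j * 1 * (τ * E.logDiv k j) * 1 := by
          have := hz.2
          have := hz.1
          gcongr
      _ = τ := by field_simp
  · simpa using hτ

theorem hasSubgaussianMGF_clipTerm {k j : Fin N} (hM : 0 < E.logDiv k j) {τ : ℝ} (hτ : 0 ≤ τ) :
    HasSubgaussianMGF (fun z => E.clipTerm k τ j z - ∫ z', E.clipTerm k τ j z' ∂(E.joint j))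
      ((‖τ‖₊ / 2) ^ 2) (E.joint j) := by
  have := hasSubgaussianMGF_of_mem_Icc (μ := E.joint j) (X := E.clipTerm k τ j) (a := 0) (b := τ)
    (E.measurable_clipTerm k τ j).aemeasurable
    ((E.ae_obs_mem j).mono fun _ hz => ⟨E.clipTerm_nonneg hM hz.1 τ, E.clipTerm_le hM hz hτ⟩)
  simpa using this

theorem integrable_clipTerm {k j : Fin N} (hM : 0 < E.logDiv k j) {τ : ℝ} (hτ : 0 ≤ τ) :
    Integrable (E.clipTerm k τ j) (E.joint j) :=
  Integrable.of_mem_Icc 0 τ (E.measurable_clipTerm k τ j).aemeasurable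
    ((E.ae_obs_mem j).mono fun _ hz => ⟨E.clipTerm_nonneg hM hz.1 τ, E.clipTerm_le hM hz hτ⟩)

theorem integrable_ratio_mul_obs {k j : Fin N}
    (hac : ∀ᵐ z ∂E.nature, E.expert k z.1 ≪ E.expert j z.1) :
    Integrable (fun z => E.ratio k j z.2 z.1.1 * obs z) (E.joint j) :=
  E.integrable_ratio_mul hac (E.integrable_obs k)

theorem integral_ratio_mul_obs {k j : Fin N}
    (hac : ∀ᵐ z ∂E.nature, E.expert k z.1 ≪ E.expert j z.1) :
    ∫ z, E.ratio k j z.2 z.1.1 * obs z ∂(E.joint j) = E.mean k :=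
  E.integral_ratio_mul hac obs

theorem integral_clipTerm_le {k j : Fin N} (h : E.FiniteDiv fLog k j) {τ : ℝ} (hτ : 0 ≤ τ) :
    ∫ z, E.clipTerm k τ j z ∂(E.joint j) ≤ 1 / E.logDiv k j * E.mean k := by
  have hM : 0 < E.logDiv k j := by linarith [E.one_le_logDiv h]
  rw [← E.integral_ratio_mul_obs h.1, ← integral_const_mul]
  refine integral_mono_ae (E.integrable_clipTerm hM hτ)
    ((E.integrable_ratio_mul_obs h.1).const_mul _) ?_
  filter_upwards [E.ae_obs_mem j] with z hz
  have hr := E.ratio_nonneg k j z.2 z.1.1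
  have := hz.1
  unfold clipTerm
  split_ifs
  · exact le_of_eq (by ring)
  · rw [mul_zero]
    positivity

/-- The bias caused by clipping. -/
theorem le_integral_clipTerm {k j : Fin N} (h : E.FiniteDiv fLog k j) {b : ℝ} (hb0 : 0 < b)
    (hb : b ≤ 2 / 3) :
    1 / E.logDiv k j * (E.mean k - b / 2) ≤
      ∫ z, E.clipTerm k (2 * Real.log (2 / b)) j z ∂(E.joint j) := by
  set τ := 2 * Real.log (2 / b) with hτ
  set M := E.logDiv k j with hMdef
  have hM1 : 1 ≤ M := E.one_le_logDiv h
  have hM : 0 < M := by linarith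
  have hexp : Real.exp (1 - τ) ≤ b / 2 := by
    have : Real.exp τ = (2 / b) ^ 2 := by
      rw [hτ, mul_comm, Real.exp_mul, Real.exp_log (by positivity)]
      norm_cast
    rw [Real.exp_sub, this, div_pow, div_div_eq_mul_div, div_le_div_iff₀ (by norm_num) two_pos]
    nlinarith [Real.exp_one_lt_d9, Real.exp_pos 1, mul_pos hb0 hb0]
  have hτ1 : 1 ≤ τ := by
    have h2 : Real.exp (1 - τ) ≤ 1 := by linarith
    have := Real.exp_le_one_iff.1 h2
    linarith
  have hpt : ∀ᵐ z ∂(E.joint j), 1 / M * (E.ratio k j z.2 z.1.1 * obs z -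
      Real.exp (1 - τ * M) * (E.ratio k j z.2 z.1.1 * Real.exp (E.ratio k j z.2 z.1.1 - 1))) ≤
      E.clipTerm k τ j z := by
    filter_upwards [E.ae_obs_mem j] with z hz
    have hr := E.ratio_nonneg k j z.2 z.1.1
    have h0 := hz.1
    set r := E.ratio k j z.2 z.1.1 with hrdef
    unfold clipTerm
    rw [← hrdef, ← hMdef]
    split_ifs with hc
    · have : 0 ≤ Real.exp (1 - τ * M) * (r * Real.exp (r - 1)) := by positivity
      have : 1 / M * (r * obs z - Real.exp (1 - τ * M) * (r * Real.exp (r - 1))) ≤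
          1 / M * (r * obs z) := mul_le_mul_of_nonneg_left (by linarith) (by positivity)
      linarith
    · rw [mul_zero]
      refine mul_nonpos_of_nonneg_of_nonpos (by positivity) ?_
      have h1 : 1 ≤ Real.exp (1 - τ * M) * Real.exp (r - 1) := by
        rw [← Real.exp_add, Real.one_le_exp_iff]
        linarith
      have := hz.2
      nlinarith
  have hi := (E.integrable_ratio_mul_exp h).const_mul (Real.exp (1 - τ * M))
  have hmono := integral_mono_ae (((E.integrable_ratio_mul_obs h.1).sub hi).const_mul (1 / M))
    (E.integrable_clipTerm hM (by linarith)) hpt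
  refine le_trans ?_ hmono
  simp only [Pi.sub_apply]
  rw [integral_const_mul, integral_sub (E.integrable_ratio_mul_obs h.1) hi, integral_const_mul,
    E.integral_ratio_mul_obs h.1, E.integral_ratio_mul_exp h, ← Real.exp_add]
  refine mul_le_mul_of_nonneg_left (sub_le_sub_left (le_trans (Real.exp_le_exp.2 ?_) hexp) _)
    (by positivity)
  nlinarith

end Env

/-! ### The parameter `β` -/

theorem betaSol_spec {c : ℝ} (hc : 0 < c) :
    0 < betaSol c ∧ betaSol c / Real.log (2 / betaSol c) = c := by
  have hex : ∃ b : ℝ, 0 < b ∧ b / Real.log (2 / b) = c := by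
    set b₀ := 2 * Real.exp (-(2 / c)) with hb₀
    have hb₀pos : 0 < b₀ := by positivity
    have hle : b₀ ≤ 2 := by
      have : Real.exp (-(2 / c)) ≤ 1 := Real.exp_le_one_iff.2 (by
        have : 0 < 2 / c := by positivity
        linarith)
      linarith
    have hcont : ContinuousOn (fun b : ℝ => b - c * Real.log (2 / b)) (Set.Icc b₀ 2) := by
      refine continuousOn_id.sub (continuousOn_const.mul (ContinuousOn.log
        (continuousOn_const.div continuousOn_id fun x hx => ?_) fun x hx => ?_))
      · exact (hb₀pos.trans_le hx.1).ne'
      · exact (div_pos two_pos (hb₀pos.trans_le hx.1)).ne'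
    have h0 : (0 : ℝ) ∈ Set.Icc (b₀ - c * Real.log (2 / b₀)) (2 - c * Real.log (2 / 2)) := by
      constructor
      · have : Real.log (2 / b₀) = 2 / c := by
          rw [hb₀, div_mul_eq_div_div, div_self two_ne_zero, one_div, ← Real.exp_neg, neg_neg,
            Real.log_exp]
        rw [this, mul_div_cancel₀ _ hc.ne']
        linarith
      · simp
    obtain ⟨b, hb, hbz⟩ := intermediate_value_Icc hle hcont h0
    have hbpos : 0 < b := hb₀pos.trans_le hb.1
    refine ⟨b, hbpos, ?_⟩
    have hbz : b - c * Real.log (2 / b) = 0 := hbz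
    have hlog : Real.log (2 / b) ≠ 0 := fun h => by
      rw [h] at hbz
      linarith
    rw [div_eq_iff hlog]
    linarith
  rw [betaSol, dif_pos hex]
  exact hex.choose_spec

theorem log_two_div_pos {b c : ℝ} (hc : 0 < c) (hb : 0 < b) (h : b / Real.log (2 / b) = c) :
    0 < Real.log (2 / b) := by
  by_contra! hn
  have := div_nonpos_of_nonneg_of_nonpos hb.le hn
  linarith

theorem div_log_mono {x b : ℝ} (hx : 0 < x) (hxb : x ≤ b) (hb : 0 < Real.log (2 / b)) :
    x / Real.log (2 / x) ≤ b / Real.log (2 / b) := by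
  have : Real.log (2 / b) ≤ Real.log (2 / x) :=
    Real.log_le_log (div_pos two_pos (hx.trans_le hxb))
      (div_le_div_of_nonneg_left two_pos.le hx hxb)
  gcongr
  exact hx.le.trans hxb

theorem nat_add_one_le_pow (n : ℕ) : (n + 1 : ℝ) ≤ (3 / 2) ^ (n + 1) := by
  induction n with
  | zero => norm_num
  | succ n ih =>
    rcases Nat.eq_zero_or_pos n with rfl | hn
    · norm_num
    · have : (1 : ℝ) ≤ n := by exact_mod_cast hn
      rw [pow_succ]
      push_cast
      linarith

theorem one_le_log_three : 1 ≤ Real.log 3 := by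
  rw [Real.le_log_iff_exp_le (by norm_num)]
  linarith [Real.exp_one_lt_d9]

theorem clipped_confidence {t : ℕ} (ht : 2 ≤ t) {Z β μ : ℝ} (hZ : 0 < Z) (hZt : Z ≤ t)
    (hβ : 0 < β) (hβ' : β ≤ 2 / 3)
    (heq : β / Real.log (2 / β) = Real.sqrt (16 * t * Real.log t) / Z)
    {S : ℝ → ℝ} (hS : Monotone S)
    (hgrid : ∀ i ≤ t, Z * (μ - (2 / 3) ^ (i + 1) / 2) -
          3 * Real.log (2 / (2 / 3) ^ (i + 1)) * Real.sqrt (t * Real.log t) ≤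
            S (2 * Real.log (2 / (2 / 3) ^ (i + 1))) ∧
        S (2 * Real.log (2 / (2 / 3) ^ (i + 1))) ≤
          Z * μ + 3 * Real.log (2 / (2 / 3) ^ (i + 1)) * Real.sqrt (t * Real.log t)) :
    |1 / Z * S (2 * Real.log (2 / β)) - μ| ≤ 3 / 2 * β := by
  have ht2 : (2 : ℝ) ≤ t := by exact_mod_cast ht
  have hlogt : 1 / 4 ≤ Real.log t := by
    have : Real.log 2 ≤ Real.log t := Real.log_le_log two_pos ht2
    linarith [Real.log_two_gt_d9]
  set q := Real.sqrt (t * Real.log t) with hq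
  have h16 : Real.sqrt (16 * t * Real.log t) = 4 * q := by
    rw [mul_assoc, Real.sqrt_mul (by norm_num), show (16 : ℝ) = 4 ^ 2 by norm_num,
      Real.sqrt_sq (by norm_num)]
  have hlog3 : Real.log 3 ≤ Real.log (2 / β) := by
    refine Real.log_le_log (by norm_num) ?_
    rw [le_div_iff₀ hβ]
    linarith
  have hL1 : 1 ≤ Real.log (2 / β) := one_le_log_three.trans hlog3
  set L := Real.log (2 / β) with hL
  have hq1 : 1 / 4 * Real.sqrt t ≤ q := by
    rw [hq, Real.sqrt_mul (by positivity), mul_comm]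
    refine mul_le_mul_of_nonneg_left (Real.le_sqrt_of_sq_le ?_) (Real.sqrt_nonneg _)
    linarith
  have hqeq : 4 * q * L = β * Z := by
    rw [h16, div_eq_div_iff (by linarith) hZ.ne'] at heq
    linarith
  have hq0 : 0 ≤ q := Real.sqrt_nonneg _
  have hst : 1 ≤ Real.sqrt t := Real.one_le_sqrt.2 (by linarith)
  have hβt : 1 / t ≤ β := by
    rw [div_le_iff₀ (by positivity)]
    nlinarith
  obtain ⟨n, hn1, hn2⟩ := exists_nat_pow_near_of_lt_one (x := 3 / 2 * β) (y := (2 / 3 : ℝ))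
    (by positivity) (by linarith) (by norm_num) (by norm_num)
  have hnt : n + 1 ≤ t := by
    have h1 := nat_add_one_le_pow n
    have h2 : (3 / 2 : ℝ) ^ (n + 1) * (2 / 3) ^ (n + 1) = 1 := by
      rw [← mul_pow]
      norm_num
    have h3 : β ≤ (2 / 3 : ℝ) ^ (n + 1) := by
      rw [pow_succ]
      linarith
    have h4 : (0 : ℝ) < (3 / 2) ^ (n + 1) := by positivity
    have h5 : (n + 1 : ℝ) * (1 / t) ≤ 1 := by
      exact (mul_le_mul h1 (hβt.trans h3) (by positivity) h4.le).trans h2.le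
    rw [mul_one_div, div_le_one (by positivity)] at h5
    exact_mod_cast h5
  have hgl := (hgrid n (by omega)).1
  have hgu := (hgrid (n + 1) hnt).2
  set b := (2 / 3 : ℝ) ^ (n + 1) with hb
  have hb0 : 0 < b := by positivity
  have hbβ : β ≤ b := by
    rw [hb, pow_succ]
    linarith
  have hbβ' : b ≤ 3 / 2 * β := hn1.le
  rw [pow_succ] at hgu
  rw [← hb] at hgu
  have hlogb : Real.log (2 / b) ≤ L :=
    Real.log_le_log (by positivity) (div_le_div_of_nonneg_left two_pos.le hβ hbβ)
  have hb'0 : 0 < b * (2 / 3) := by positivity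
  have hlogb1 : L ≤ Real.log (2 / (b * (2 / 3))) :=
    Real.log_le_log (by positivity) (div_le_div_of_nonneg_left two_pos.le hb'0 (by linarith))
  have hlogb2 : Real.log (2 / (b * (2 / 3))) ≤ 2 * L := by
    have h1 : 2 / (b * (2 / 3)) ≤ (2 / β) * 3 := by
      rw [div_mul_eq_mul_div, div_le_div_iff₀ hb'0 hβ]
      nlinarith
    calc Real.log (2 / (b * (2 / 3))) ≤ Real.log ((2 / β) * 3) :=
          Real.log_le_log (by positivity) h1
      _ = L + Real.log 3 := Real.log_mul (by positivity) (by norm_num)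
      _ ≤ 2 * L := by linarith
  have hSl := hS (mul_le_mul_of_nonneg_left hlogb two_pos.le)
  have hSu := hS (mul_le_mul_of_nonneg_left hlogb1 two_pos.le)
  have e1 : Real.log (2 / b) * q ≤ L * q := mul_le_mul_of_nonneg_right hlogb hq0
  have e2 : Real.log (2 / (b * (2 / 3))) * q ≤ 2 * L * q := mul_le_mul_of_nonneg_right hlogb2 hq0
  have e3 : Z * b ≤ Z * (3 / 2 * β) := mul_le_mul_of_nonneg_left hbβ' hZ.le
  have hrew : 1 / Z * S (2 * L) - μ = (S (2 * L) - Z * μ) / Z := by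
    field_simp
  rw [hrew, abs_le, le_div_iff₀ hZ, div_le_iff₀ hZ]
  constructor <;> nlinarith

/-! ### D-UCB with the clipped estimator -/

namespace Run

variable {𝒳 : Type*} [MeasurableSpace 𝒳] {K N : ℕ} {E : Env 𝒳 K N}
  {Ω : Type*} [mΩ : MeasurableSpace Ω] (run : Run E Ω)

theorem clipZ_eq (k : Fin N) (t : ℕ) (ω : Ω) :
    clipZ E (run.path ω) k t = ∑ s ∈ Finset.range t, 1 / E.logDiv k (run.expert (s + 1) ω) := by
  rw [← sum_times (fun s => run.expert s ω) t fun j _ => 1 / E.logDiv k j]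
  unfold clipZ
  refine Finset.sum_congr rfl fun j _ => ?_
  rw [Finset.sum_const, nsmul_eq_mul, mul_one_div]
  rfl

theorem clippedMean_eq (k : Fin N) (t : ℕ) (ε : ℝ) (ω : Ω) :
    clippedMean E (run.path ω) k t ε = 1 / clipZ E (run.path ω) k t * ∑ s ∈ Finset.range t,
      E.clipTerm k (2 * Real.log (2 / ε)) (run.expert (s + 1) ω) (run.step (s + 1) ω) := by
  rw [← sum_times (fun s => run.expert s ω) t fun j s =>
    E.clipTerm k (2 * Real.log (2 / ε)) j (run.step s ω)]
  rfl

/-- The event that the sum of the terms clipped at level `τ` is far from its compensator. -/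
def clipBad (k : Fin N) (t : ℕ) (b : ℝ) : Set Ω :=
  {ω | 3 * Real.log (2 / b) * Real.sqrt (t * Real.log t) ≤
    |∑ s ∈ Finset.range t, (E.clipTerm k (2 * Real.log (2 / b)) (run.expert (s + 1) ω)
        (run.step (s + 1) ω) - ∫ z, E.clipTerm k (2 * Real.log (2 / b))
          (run.expert (s + 1) ω) z ∂(E.joint (run.expert (s + 1) ω)))|}

theorem measure_clipBad_le (hdiv : ∀ i j, E.FiniteDiv Env.fLog i j) (k : Fin N) {t : ℕ}
    (ht : 2 ≤ t) {b : ℝ} (hb0 : 0 < b) (hb : b ≤ 2 / 3) :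
    run.law (run.clipBad k t b) ≤ ENNReal.ofReal (2 * (1 / (t : ℝ) ^ 4)) := by
  have ht2 : (2 : ℝ) ≤ t := by exact_mod_cast ht
  have hlogt : 0 < Real.log t := Real.log_pos (by linarith)
  have hL : 0 < Real.log (2 / b) := Real.log_pos (by
    rw [lt_div_iff₀ hb0]
    linarith)
  set τ := 2 * Real.log (2 / b) with hτ
  have hτ0 : 0 < τ := by positivity
  have hM : ∀ j, 0 < E.logDiv k j := fun j => by linarith [E.one_le_logDiv (hdiv k j)]
  set x := 3 * Real.log (2 / b) * Real.sqrt (t * Real.log t) with hx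
  have hx0 : 0 ≤ x := by positivity
  set f : Fin N → (𝒳 × (Fin K → ℝ)) × Fin K → ℝ := fun j z =>
    E.clipTerm k τ j z - ∫ z, E.clipTerm k τ j z ∂(E.joint j) with hf
  have hfm : ∀ j, Measurable (f j) := fun j => (E.measurable_clipTerm k τ j).sub_const _
  have hsub : ∀ j, HasSubgaussianMGF (f j) ((‖τ‖₊ / 2) ^ 2) (E.joint j) := fun j =>
    E.hasSubgaussianMGF_clipTerm (hM j) hτ0.le
  have hc : 0 < (‖τ‖₊ / 2) ^ 2 := by
    have : 0 < ‖τ‖₊ := nnnorm_pos.2 hτ0.ne'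
    positivity
  have h1 := run.measure_sum_ge_le hfm hc hsub (by omega : 0 < t) hx0
  have h2 := run.measure_sum_ge_le (f := fun j => -f j) (fun j => (hfm j).neg) hc
    (fun j => (hsub j).neg) (by omega : 0 < t) hx0
  have hexp : Real.exp (-(x ^ 2 / (2 * t * ((‖τ‖₊ / 2) ^ 2 : ℝ≥0)))) ≤ 1 / (t : ℝ) ^ 4 := by
    have e1 : x ^ 2 / (2 * t * ((‖τ‖₊ / 2) ^ 2 : ℝ≥0)) = 9 / 2 * Real.log t := by
      push_cast
      rw [Real.norm_eq_abs, abs_of_pos hτ0, hx, mul_pow, Real.sq_sqrt (by positivity),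
        hτ]
      field_simp
      ring
    rw [e1, ← Real.exp_log (show (0 : ℝ) < 1 / (t : ℝ) ^ 4 by positivity), one_div, Real.log_inv,
      Real.log_pow]
    refine Real.exp_le_exp.2 ?_
    push_cast
    linarith
  have hsubset : run.clipBad k t b ⊆
      {ω | x ≤ ∑ s ∈ Finset.range t, f (run.expert (s + 1) ω) (run.step (s + 1) ω)} ∪
      {ω | x ≤ ∑ s ∈ Finset.range t, (-f (run.expert (s + 1) ω)) (run.step (s + 1) ω)} := by
    intro ω hω
    simp only [Pi.neg_apply, Finset.sum_neg_distrib]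
    have hω : x ≤ |∑ s ∈ Finset.range t, f (run.expert (s + 1) ω) (run.step (s + 1) ω)| := hω
    exact le_abs.1 hω
  calc run.law (run.clipBad k t b) ≤ _ := measure_mono hsubset
    _ ≤ _ := measure_union_le _ _
    _ ≤ _ := add_le_add (h1.trans (ENNReal.ofReal_le_ofReal hexp))
        (h2.trans (ENNReal.ofReal_le_ofReal hexp))
    _ = _ := by
        rw [← ENNReal.ofReal_add (by positivity) (by positivity), two_mul]

theorem clipZ_le (hdiv : ∀ i j, E.FiniteDiv Env.fLog i j) (k : Fin N) (t : ℕ) (ω : Ω) :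
    clipZ E (run.path ω) k t ≤ t := by
  rw [run.clipZ_eq]
  calc _ ≤ ∑ s ∈ Finset.range t, (1 : ℝ) := Finset.sum_le_sum fun s _ => by
        have := E.one_le_logDiv (hdiv k (run.expert (s + 1) ω))
        rw [div_le_one (by linarith)]
        exact this
    _ = t := by simp

theorem le_clipZ (hdiv : ∀ i j, E.FiniteDiv Env.fLog i j) (k : Fin N) (t : ℕ) (ω : Ω) :
    t / E.logDivMax ≤ clipZ E (run.path ω) k t := by
  rw [run.clipZ_eq]
  calc (t : ℝ) / E.logDivMax = ∑ s ∈ Finset.range t, 1 / E.logDivMax := by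
        rw [Finset.sum_const, Finset.card_range, nsmul_eq_mul, mul_one_div]
    _ ≤ _ := Finset.sum_le_sum fun s _ => by
        have := E.one_le_logDiv (hdiv k (run.expert (s + 1) ω))
        exact div_le_div_of_nonneg_left zero_le_one (by linarith) (E.logDiv_le_logDivMax _ _)

theorem abs_clippedMean_sub_le (hdiv : ∀ i j, E.FiniteDiv Env.fLog i j) (k : Fin N) {t : ℕ}
    (ht : 2 ≤ t) {ω : Ω} (hrew : ∀ s, Env.obs (run.step (s + 1) ω) ∈ Set.Icc (0 : ℝ) 1)
    (hgood : ∀ i ≤ t, ω ∉ run.clipBad k t ((2 / 3) ^ (i + 1)))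
    (hZ : 0 < clipZ E (run.path ω) k t) {β : ℝ} (hβ : 0 < β) (hβ' : β ≤ 2 / 3)
    (heq : β / Real.log (2 / β) = Real.sqrt (16 * t * Real.log t) / clipZ E (run.path ω) k t) :
    |clippedMean E (run.path ω) k t β - E.mean k| ≤ 3 / 2 * β := by
  rw [run.clippedMean_eq]
  have hM : ∀ j, 0 < E.logDiv k j := fun j => by linarith [E.one_le_logDiv (hdiv k j)]
  refine clipped_confidence ht hZ (run.clipZ_le hdiv k t ω) hβ hβ' heq (S := fun τ =>
    ∑ s ∈ Finset.range t, E.clipTerm k τ (run.expert (s + 1) ω) (run.step (s + 1) ω))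
    (fun τ τ' h => Finset.sum_le_sum fun s _ =>
      E.clipTerm_mono (hM _) (hrew s).1 h) fun i hi => ?_
  set b := (2 / 3 : ℝ) ^ (i + 1) with hb
  have hb0 : 0 < b := by positivity
  have hb1 : b ≤ 2 / 3 := by
    rw [hb, pow_succ]
    have : (2 / 3 : ℝ) ^ i ≤ 1 := pow_le_one₀ (by norm_num) (by norm_num)
    linarith
  have hL : 0 ≤ Real.log (2 / b) := Real.log_nonneg (by
    rw [le_div_iff₀ hb0]
    linarith)
  have h := hgood i hi
  rw [clipBad, Set.mem_ofPred_eq, not_le, Finset.sum_sub_distrib, abs_lt] at h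
  have hlow : clipZ E (run.path ω) k t * (E.mean k - b / 2) ≤
      ∑ s ∈ Finset.range t, ∫ z, E.clipTerm k (2 * Real.log (2 / b))
          (run.expert (s + 1) ω) z ∂(E.joint (run.expert (s + 1) ω)) := by
    rw [run.clipZ_eq, Finset.sum_mul]
    exact Finset.sum_le_sum fun s _ => E.le_integral_clipTerm (hdiv _ _) hb0 hb1
  have hup : ∑ s ∈ Finset.range t, ∫ z, E.clipTerm k (2 * Real.log (2 / b))
          (run.expert (s + 1) ω) z ∂(E.joint (run.expert (s + 1) ω)) ≤
      clipZ E (run.path ω) k t * E.mean k := by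
    rw [run.clipZ_eq, Finset.sum_mul]
    exact Finset.sum_le_sum fun s _ => E.integral_clipTerm_le (hdiv _ _) (by positivity)
  constructor <;> linarith [h.1, h.2]

theorem gap_le_of_clippedUCB (hdiv : ∀ i j, E.FiniteDiv Env.fLog i j) (hN : 2 ≤ N) {d : ℝ}
    (hd : 0 < d) (hgap : E.sortedGap 2 = d) {t T : ℕ} (ht : 2 ≤ t) (htT : t ≤ T) {ω : Ω}
    (hrew : ∀ s, Env.obs (run.step (s + 1) ω) ∈ Set.Icc (0 : ℝ) 1)
    (hucb : ∀ j, clippedUCB E (run.path ω) j t ≤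
      clippedUCB E (run.path ω) (run.expert (t + 1) ω) t)
    (hgood : ∀ k, ∀ i ≤ t, ω ∉ run.clipBad k t ((2 / 3) ^ (i + 1))) :
    E.gap (run.expert (t + 1) ω) ≤
      Real.sqrt (144 * E.logDivMax ^ 2 * Real.log (6 / d) ^ 2 * Real.log T / t) := by
  have ht2 : (2 : ℝ) ≤ t := by exact_mod_cast ht
  have hlogt : 0 < Real.log t := Real.log_pos (by linarith)
  have hlogT : Real.log t ≤ Real.log T := Real.log_le_log (by positivity) (by exact_mod_cast htT)
  set k := run.expert (t + 1) ω with hk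
  have hMmax : 1 ≤ E.logDivMax := (E.one_le_logDiv (hdiv k k)).trans (E.logDiv_le_logDivMax k k)
  have hZ : ∀ i, 0 < clipZ E (run.path ω) i t := fun i =>
    lt_of_lt_of_le (by positivity) (run.le_clipZ hdiv i t ω)
  have hc : ∀ i, 0 < Real.sqrt (16 * t * Real.log t) / clipZ E (run.path ω) i t := fun i =>
    div_pos (Real.sqrt_pos.2 (by positivity)) (hZ i)
  have hβ : ∀ i, 0 < beta E (run.path ω) i t := fun i => (betaSol_spec (hc i)).1
  have heq : ∀ i, beta E (run.path ω) i t / Real.log (2 / beta E (run.path ω) i t) =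
    Real.sqrt (16 * t * Real.log t) / clipZ E (run.path ω) i t := fun i =>
      (betaSol_spec (hc i)).2
  have hconf : ∀ i, beta E (run.path ω) i t ≤ 2 / 3 →
      |clippedMean E (run.path ω) i t (beta E (run.path ω) i t) - E.mean i| ≤
        3 / 2 * beta E (run.path ω) i t := fun i hi =>
    run.abs_clippedMean_sub_le hdiv i ht hrew (hgood i) (hZ i) (hβ i) hi (heq i)
  have hgapβ : E.gap k ≤ 3 * beta E (run.path ω) k t := by
    by_cases h3 : 1 / 3 ≤ beta E (run.path ω) k t
    · linarith [E.gap_le_one k]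
    · obtain ⟨o, ho⟩ := E.exists_gap_eq_zero (by omega)
      have hlow : E.mean o ≤ clippedUCB E (run.path ω) o t := by
        unfold clippedUCB
        by_cases h2 : beta E (run.path ω) o t ≤ 2 / 3
        · linarith [(abs_le.1 (hconf o h2)).1]
        · have : 0 ≤ clippedMean E (run.path ω) o t (beta E (run.path ω) o t) := by
            rw [run.clippedMean_eq]
            refine mul_nonneg (by have := hZ o; positivity) (Finset.sum_nonneg fun s _ => ?_)
            exact E.clipTerm_nonneg (by linarith [E.one_le_logDiv (hdiv o (run.expert (s + 1) ω))])
              (hrew s).1 _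
          linarith [(E.mean_mem o).2]
      have hup : clippedUCB E (run.path ω) k t ≤ E.mean k + 3 * beta E (run.path ω) k t := by
        unfold clippedUCB
        linarith [(abs_le.1 (hconf k (by linarith))).2]
      have := hucb o
      unfold Env.gap at ho ⊢
      linarith
  rcases E.gap_eq_zero_or_le k hN with h0 | h0
  · rw [h0]
    positivity
  rw [hgap] at h0
  set Δ := E.gap k with hΔ
  have hΔ0 : 0 < Δ := hd.trans_le h0
  have hΔ1 : Δ ≤ 1 := E.gap_le_one k
  have hL := log_two_div_pos (hc k) (hβ k) (heq k)
  have h1 := div_log_mono (by positivity : 0 < Δ / 3) (by linarith) hL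
  rw [heq k, show 2 / (Δ / 3) = 6 / Δ by field_simp; norm_num] at h1
  have hlogΔ : 0 < Real.log (6 / Δ) := Real.log_pos (by
    rw [lt_div_iff₀ hΔ0]
    linarith)
  have hlogd : Real.log (6 / Δ) ≤ Real.log (6 / d) :=
    Real.log_le_log (by positivity) (div_le_div_of_nonneg_left (by norm_num) hd h0)
  have h2 : Real.sqrt (16 * t * Real.log t) / clipZ E (run.path ω) k t ≤
      Real.sqrt (16 * t * Real.log T) / (t / E.logDivMax) :=
    div_le_div₀ (Real.sqrt_nonneg _) (Real.sqrt_le_sqrt (by gcongr)) (by positivity)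
      (run.le_clipZ hdiv k t ω)
  have h3 := h1.trans h2
  rw [div_le_iff₀ hlogΔ] at h3
  have h4 : Δ ≤ 3 * (Real.sqrt (16 * t * Real.log T) / (t / E.logDivMax) * Real.log (6 / d)) := by
    have : Real.sqrt (16 * t * Real.log T) / (t / E.logDivMax) * Real.log (6 / Δ) ≤
        Real.sqrt (16 * t * Real.log T) / (t / E.logDivMax) * Real.log (6 / d) :=
      mul_le_mul_of_nonneg_left hlogd (by positivity)
    linarith
  refine Real.le_sqrt_of_sq_le ((pow_le_pow_left₀ hΔ0.le h4 2).trans (le_of_eq ?_))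
  rw [mul_pow, mul_pow, div_pow, Real.sq_sqrt (by have := hlogt.le.trans hlogT; positivity)]
  field_simp
  ring

theorem regret_le_of_isClippedUCB (hucb : run.IsClippedUCB)
    (hdiv : ∀ i j, E.FiniteDiv Env.fLog i j) (hN : 2 ≤ N) {d : ℝ}
    (hd : 0 < d) (hgap : E.sortedGap 2 = d) (T : ℕ) :
    run.regret T ≤ 2 + 8 * N +
      2 * (144 * E.logDivMax ^ 2 * Real.log (6 / d) ^ 2 * Real.log T) / d := by
  have hlogT : 0 ≤ Real.log T := Real.log_natCast_nonneg T
  have := run.regret_le hN hd hgap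
    (A := 144 * E.logDivMax ^ 2 * Real.log (6 / d) ^ 2 * Real.log T) (by positivity)
    (c := 4 * N) (by positivity) 2 T fun t ht htT => ?_
  · push_cast at this
    linarith
  have ht0 : (0 : ℝ) < t := by positivity
  refine ⟨⋃ k : Fin N, ⋃ i ∈ Finset.range (t + 1), run.clipBad k t ((2 / 3) ^ (i + 1)), ?_, ?_⟩
  · calc _ ≤ ∑ k : Fin N, ∑ i ∈ Finset.range (t + 1),
            run.law (run.clipBad k t ((2 / 3) ^ (i + 1))) :=
          (measure_iUnion_fintype_le _ _).trans
            (Finset.sum_le_sum fun k _ => measure_biUnion_finset_le _ _)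
      _ ≤ ∑ k : Fin N, ∑ i ∈ Finset.range (t + 1), ENNReal.ofReal (2 * (1 / (t : ℝ) ^ 4)) := by
          refine Finset.sum_le_sum fun k _ => Finset.sum_le_sum fun i _ =>
            run.measure_clipBad_le hdiv k ht (by positivity) ?_
          rw [pow_succ]
          have : (2 / 3 : ℝ) ^ i ≤ 1 := pow_le_one₀ (by norm_num) (by norm_num)
          linarith
      _ = ENNReal.ofReal (N * ((t + 1) * (2 * (1 / (t : ℝ) ^ 4)))) := by
          rw [ENNReal.ofReal_mul (by positivity : (0 : ℝ) ≤ N),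
            ENNReal.ofReal_mul (by positivity : (0 : ℝ) ≤ t + 1)]
          simp only [Finset.sum_const, Finset.card_univ, Fintype.card_fin, Finset.card_range,
            nsmul_eq_mul]
          rw [ENNReal.ofReal_natCast, ← Nat.cast_add_one (R := ℝ), ENNReal.ofReal_natCast]
      _ ≤ _ := by
          refine ENNReal.ofReal_le_ofReal ?_
          have h2 : (2 : ℝ) ≤ t := by exact_mod_cast ht
          have : (t + 1) * (2 * (1 / (t : ℝ) ^ 4)) ≤ 4 * (1 / (t : ℝ) ^ 2) := by
            rw [mul_one_div, mul_one_div, mul_div_assoc', div_le_div_iff₀ (by positivity)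
              (by positivity)]
            have : (t : ℝ) + 1 ≤ 2 * t ^ 2 := by nlinarith
            nlinarith [mul_le_mul_of_nonneg_right this (by positivity : (0 : ℝ) ≤ 2 * t ^ 2)]
          calc _ ≤ (N : ℝ) * (4 * (1 / (t : ℝ) ^ 2)) :=
                mul_le_mul_of_nonneg_left this (by positivity)
            _ = _ := by ring
  · filter_upwards [hucb, run.ae_obs_step_mem] with ω h1 h2 hω
    simp only [Set.mem_iUnion, not_exists] at hω
    exact run.gap_le_of_clippedUCB hdiv hN hd hgap ht htT.le h2 (h1 t ht) fun k i hi =>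
      hω k i (Finset.mem_range.2 (by omega))

end Run

end StochasticExperts

namespace StochasticExperts

open scoped ENNReal NNReal

/-! ### The median of means estimator -/

namespace Env

variable {𝒳 : Type*} [MeasurableSpace 𝒳] {K N : ℕ} (E : Env 𝒳 K N)

/-- The centred importance weighted reward, divided by `σ_kj`. -/
noncomputable def chiTerm (k j : Fin N) (z : (𝒳 × (Fin K → ℝ)) × Fin K) : ℝ :=
  1 / E.chiDiv k j * (E.ratio k j z.2 z.1.1 * obs z - E.mean k)

theorem measurable_chiTerm (k j : Fin N) : Measurable (E.chiTerm k j) :=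
  (((E.measurable_ratio k j).mul measurable_obs).sub_const _).const_mul _

theorem integrable_chiTerm {k j : Fin N} (h : E.FiniteDiv fChi k j) :
    Integrable (E.chiTerm k j) (E.joint j) :=
  ((E.integrable_ratio_mul_obs h.1).sub (integrable_const _)).const_mul _

theorem integral_chiTerm {k j : Fin N} (h : E.FiniteDiv fChi k j) :
    ∫ z, E.chiTerm k j z ∂(E.joint j) = 0 := by
  unfold chiTerm
  rw [integral_const_mul, integral_sub (E.integrable_ratio_mul_obs h.1) (integrable_const _),
    E.integral_ratio_mul_obs h.1]
  simp

theorem ratio_mul_obs_sq_le {k j : Fin N} {z : (𝒳 × (Fin K → ℝ)) × Fin K}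
    (hz : obs z ∈ Set.Icc (0 : ℝ) 1) :
    (E.ratio k j z.2 z.1.1 * obs z) ^ 2 ≤ E.ratio k j z.2 z.1.1 ^ 2 := by
  rw [mul_pow]
  exact mul_le_of_le_one_right (sq_nonneg _) (pow_le_one₀ hz.1 hz.2)

theorem integrable_ratio_mul_obs_sq {k j : Fin N} (h : E.FiniteDiv fChi k j) :
    Integrable (fun z => (E.ratio k j z.2 z.1.1 * obs z) ^ 2) (E.joint j) := by
  refine (E.integrable_ratio_sq h).mono'
    (((E.measurable_ratio k j).mul measurable_obs).pow_const 2).aestronglyMeasurable ?_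
  filter_upwards [E.ae_obs_mem j] with z hz
  rw [Real.norm_eq_abs, abs_of_nonneg (sq_nonneg _)]
  exact E.ratio_mul_obs_sq_le hz

theorem chiTerm_sq (k j : Fin N) (z : (𝒳 × (Fin K → ℝ)) × Fin K) :
    E.chiTerm k j z ^ 2 = (1 / E.chiDiv k j) ^ 2 * ((E.ratio k j z.2 z.1.1 * obs z) ^ 2 -
      2 * E.mean k * (E.ratio k j z.2 z.1.1 * obs z) + E.mean k ^ 2) := by
  unfold chiTerm
  ring

theorem integrable_chiTerm_sq {k j : Fin N} (h : E.FiniteDiv fChi k j) :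
    Integrable (fun z => E.chiTerm k j z ^ 2) (E.joint j) := by
  simp only [chiTerm_sq]
  exact (((E.integrable_ratio_mul_obs_sq h).sub
    ((E.integrable_ratio_mul_obs h.1).const_mul _)).add (integrable_const _)).const_mul _

theorem integral_chiTerm_sq_le {k j : Fin N} (h : E.FiniteDiv fChi k j) :
    ∫ z, E.chiTerm k j z ^ 2 ∂(E.joint j) ≤ 1 := by
  have hσ : 0 < E.chiDiv k j := by linarith [E.one_le_chiDiv h]
  have h1 : ∫ z, (E.ratio k j z.2 z.1.1 * obs z) ^ 2 ∂(E.joint j) ≤ E.chiDiv k j ^ 2 := by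
    rw [← E.integral_ratio_sq h]
    exact integral_mono_ae (E.integrable_ratio_mul_obs_sq h) (E.integrable_ratio_sq h)
      ((E.ae_obs_mem j).mono fun z hz => E.ratio_mul_obs_sq_le hz)
  have h2 : Integrable (fun z => (E.ratio k j z.2 z.1.1 * obs z) ^ 2 -
      2 * E.mean k * (E.ratio k j z.2 z.1.1 * obs z)) (E.joint j) :=
    (E.integrable_ratio_mul_obs_sq h).sub ((E.integrable_ratio_mul_obs h.1).const_mul _)
  simp only [chiTerm_sq]
  rw [integral_const_mul, integral_add h2 (integrable_const _),
    integral_sub (E.integrable_ratio_mul_obs_sq h) ((E.integrable_ratio_mul_obs h.1).const_mul _),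
    integral_const_mul, E.integral_ratio_mul_obs h.1]
  simp only [integral_const, probReal_univ, smul_eq_mul, one_mul]
  rw [one_div, inv_pow, inv_mul_le_iff₀ (by positivity)]
  nlinarith [sq_nonneg (E.mean k)]

/-- The quadratic potential grows at most by the factor `1 + 1 / a` in one step. -/
theorem lintegral_one_add_sq_le {k j : Fin N} (h : E.FiniteDiv fChi k j) {a : ℝ} (ha : 0 < a)
    (S : ℝ) :
    ∫⁻ z, ENNReal.ofReal (1 + (S + E.chiTerm k j z) ^ 2 / a) ∂(E.joint j) ≤
      ENNReal.ofReal (1 + 1 / a) * ENNReal.ofReal (1 + S ^ 2 / a) := by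
  have i1 := E.integrable_chiTerm h
  have i2 := E.integrable_chiTerm_sq h
  have e : ∀ z, 1 + (S + E.chiTerm k j z) ^ 2 / a =
      (1 + S ^ 2 / a) + 2 * S / a * E.chiTerm k j z + 1 / a * E.chiTerm k j z ^ 2 := fun z => by
    ring
  have i4 : Integrable (fun z => (1 + S ^ 2 / a) + 2 * S / a * E.chiTerm k j z) (E.joint j) :=
    (integrable_const _).add (i1.const_mul _)
  have i3 : Integrable (fun z => 1 + (S + E.chiTerm k j z) ^ 2 / a) (E.joint j) := by
    simp only [e]
    exact i4.add (i2.const_mul _)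
  rw [← ofReal_integral_eq_lintegral_ofReal i3 (Filter.Eventually.of_forall fun z => by positivity),
    ← ENNReal.ofReal_mul (by positivity)]
  refine ENNReal.ofReal_le_ofReal ?_
  simp only [e]
  rw [integral_add i4 (i2.const_mul _),
    integral_add (integrable_const _) (i1.const_mul _), integral_const_mul, integral_const_mul,
    E.integral_chiTerm h]
  simp only [integral_const, probReal_univ, smul_eq_mul, one_mul, mul_zero, add_zero]
  have h1 : 1 / a * ∫ z, E.chiTerm k j z ^ 2 ∂(E.joint j) ≤ 1 / a * 1 :=
    mul_le_mul_of_nonneg_left (E.integral_chiTerm_sq_le h) (by positivity)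
  have h2 : 0 ≤ 1 / a * (S ^ 2 / a) := by positivity
  linarith

end Env

theorem prod_update_add {l : ℕ} (ψ : ℝ → ℝ≥0∞) (S : Fin l → ℝ) (x : ℝ) (r : Fin l) :
    ∏ i, ψ (S i + if (r : ℕ) = i then x else 0) =
      ψ (S r + x) * ∏ i ∈ Finset.univ.erase r, ψ (S i) := by
  rw [← Finset.mul_prod_erase _ _ (Finset.mem_univ r), if_pos rfl]
  congr 1
  refine Finset.prod_congr rfl fun i hi => ?_
  rw [if_neg, add_zero]
  exact fun h => (Finset.ne_of_mem_erase hi) (Fin.ext h.symm)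

namespace Run

variable {𝒳 : Type*} [MeasurableSpace 𝒳] {K N : ℕ} {E : Env 𝒳 K N}
  {Ω : Type*} [mΩ : MeasurableSpace Ω] (run : Run E Ω)

/-- The sum over the times in `1, …, t` that `g` assigns to the group `r`. -/
def groupSum (f : Fin N → (𝒳 × (Fin K → ℝ)) × Fin K → ℝ) (g : ℕ → Ω → ℕ) (t r : ℕ) (ω : Ω) : ℝ :=
  ∑ s ∈ Finset.range t,
    if g (s + 1) ω = r then f (run.expert (s + 1) ω) (run.step (s + 1) ω) else 0

theorem measurable_groupSum {f : Fin N → (𝒳 × (Fin K → ℝ)) × Fin K → ℝ}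
    (hf : ∀ j, Measurable (f j)) {g : ℕ → Ω → ℕ} (hg : ∀ s, Measurable[run.ℱ s] (g (s + 1)))
    (t r : ℕ) : Measurable[run.ℱ t] (run.groupSum f g t r) := by
  refine Finset.measurable_fun_sum _ fun s hs => ?_
  have hs := Finset.mem_range.1 hs
  have h1 : Measurable[run.ℱ t] fun ω => (run.expert (s + 1) ω, run.step (s + 1) ω) :=
    ((run.expert_meas s).mono (run.ℱ.mono hs.le) le_rfl).prodMk
      ((run.measurable_step_filtration s).mono (run.ℱ.mono hs) le_rfl)
  have h2 : Measurable[run.ℱ t] (g (s + 1)) := (hg s).mono (run.ℱ.mono hs.le) le_rfl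
  exact Measurable.ite (h2 (measurableSet_singleton r))
    ((measurable_from_prod_countable_right hf :
      Measurable fun q : Fin N × ((𝒳 × (Fin K → ℝ)) × Fin K) => f q.1 q.2).comp h1)
    measurable_const

/-- If in one step the potential `ψ` grows at most by the factor `B` on average, then so does the
product of the potentials of the sums over the groups of a predictable grouping. -/
theorem lintegral_prod_groupSum_le {f : Fin N → (𝒳 × (Fin K → ℝ)) × Fin K → ℝ}
    (hf : ∀ j, Measurable (f j)) {g : ℕ → Ω → ℕ} (hg : ∀ s, Measurable[run.ℱ s] (g (s + 1)))
    {ψ : ℝ → ℝ≥0∞} (hψ : Measurable ψ) (hψ0 : ψ 0 = 1) {B : ℝ≥0∞}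
    (hB : ∀ j S, ∫⁻ z, ψ (S + f j z) ∂(E.joint j) ≤ B * ψ S) {l : ℕ}
    (hgl : ∀ s ω, g s ω < l) (t : ℕ) :
    ∫⁻ ω, ∏ r : Fin l, ψ (run.groupSum f g t r ω) ∂run.law ≤ B ^ t := by
  induction t with
  | zero => simp [groupSum, hψ0]
  | succ t ih =>
    have hfm : Measurable fun q : Fin N × ((𝒳 × (Fin K → ℝ)) × Fin K) => f q.1 q.2 :=
      measurable_from_prod_countable_right hf
    have hφ : Measurable[run.ℱ t] fun ω =>
        (g (t + 1) ω, fun r : Fin l => run.groupSum f g t r ω) :=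
      (hg t).prodMk (@measurable_pi_lambda _ _ _ (run.ℱ t) _ _ fun r =>
        run.measurable_groupSum hf hg t r)
    have hF : Measurable (Function.uncurry fun (q : Fin N × (ℕ × (Fin l → ℝ))) z =>
        ∏ r : Fin l, ψ (q.2.2 r + if q.2.1 = r then f q.1 z else 0)) := by
      refine Finset.measurable_fun_prod _ fun r _ => hψ.comp (Measurable.add ?_ ?_)
      · exact (measurable_pi_apply r).comp
          (measurable_snd.comp (measurable_snd.comp measurable_fst))
      · refine Measurable.ite ?_ (hfm.comp ((measurable_fst.comp measurable_fst).prodMk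
          measurable_snd)) measurable_const
        exact (measurable_fst.comp (measurable_snd.comp measurable_fst))
          (measurableSet_singleton (r : ℕ))
    have := run.lintegral_step t hφ hF
    have e : ∀ ω, ∏ r : Fin l, ψ (run.groupSum f g (t + 1) r ω) =
        ∏ r : Fin l, ψ (run.groupSum f g t r ω + if g (t + 1) ω = r then
          f (run.expert (t + 1) ω) (run.step (t + 1) ω) else 0) := fun ω => by
      simp only [groupSum, Finset.sum_range_succ]
    simp only [e]
    rw [this]
    calc _ ≤ ∫⁻ ω, B * ∏ r : Fin l, ψ (run.groupSum f g t r ω) ∂run.law := by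
          refine lintegral_mono fun ω => ?_
          obtain ⟨r, hr⟩ : ∃ r : Fin l, (r : ℕ) = g (t + 1) ω := ⟨⟨_, hgl _ ω⟩, rfl⟩
          simp only [← hr]
          simp only [prod_update_add ψ (fun r : Fin l => run.groupSum f g t r ω) _ r]
          have hm : Measurable fun z => ψ (run.groupSum f g t r ω + f (run.expert (t + 1) ω) z) :=
            hψ.comp ((hf _).const_add _)
          rw [lintegral_mul_const _ hm,
            ← Finset.mul_prod_erase Finset.univ (fun r : Fin l => ψ (run.groupSum f g t r ω))
              (Finset.mem_univ r), ← mul_assoc]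
          exact mul_le_mul_left (hB _ _) _
      _ = B * ∫⁻ ω, ∏ r : Fin l, ψ (run.groupSum f g t r ω) ∂run.law := by
          refine lintegral_const_mul _ (Finset.measurable_fun_prod _ fun r _ => hψ.comp ?_)
          exact (run.measurable_groupSum hf hg t r).mono (run.ℱ.le t) le_rfl
      _ ≤ B * B ^ t := mul_le_mul_right ih _
      _ = B ^ (t + 1) := (pow_succ' _ _).symm

theorem measurable_group (G : Grouping N) (t s : ℕ) :
    Measurable[run.ℱ s] fun ω => G.group t (fun u => run.expert u ω) (s + 1) := by
  set F : (Fin (s + 1) → Fin N) → ℕ := fun v =>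
    G.group t (fun u => if h : u - 1 < s + 1 then v ⟨u - 1, h⟩ else v 0) (s + 1) with hF
  have h1 : Measurable[run.ℱ s] fun ω => fun i : Fin (s + 1) => run.expert (i + 1) ω :=
    @measurable_pi_lambda _ _ _ (run.ℱ s) _ _ fun i =>
      (run.expert_meas i).mono (run.ℱ.mono (Nat.lt_succ_iff.1 i.2)) le_rfl
  have h2 : (fun ω => G.group t (fun u => run.expert u ω) (s + 1)) =
      F ∘ fun ω => fun i : Fin (s + 1) => run.expert (i + 1) ω := by
    funext ω
    refine G.no_lookahead t _ _ _ fun u hu hus => ?_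
    rw [dif_pos (by omega)]
    simp only [Nat.sub_add_cancel hu]
  rw [h2]
  exact (measurable_of_countable F).comp h1

end Run

end StochasticExperts

namespace StochasticExperts

open scoped ENNReal NNReal

/-! ### D-UCB with the median of means estimator -/

theorem log_one_div_one_div_sq (t : ℕ) : Real.log (1 / (1 / (t : ℝ) ^ 2)) = 2 * Real.log t := by
  rw [one_div_one_div, Real.log_pow]
  norm_num

theorem numGroups_le {t : ℕ} : (numGroups t : ℝ) ≤ 16 * Real.log t := by
  have h := Real.log_natCast_nonneg t
  unfold numGroups
  rw [log_one_div_one_div_sq]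
  refine (Nat.floor_le (by positivity)).trans (by linarith)

theorem sub_one_lt_numGroups {t : ℕ} : 16 * Real.log t - 1 < numGroups t := by
  unfold numGroups
  rw [log_one_div_one_div_sq]
  have := Nat.sub_one_lt_floor (8 * (2 * Real.log (t : ℝ)))
  linarith

theorem exp_le_three : Real.exp (16 / 15) ≤ 3 := by
  have h : Real.exp (16 / 15) ^ 15 ≤ 3 ^ 15 := by
    rw [← Real.exp_nat_mul, show ((15 : ℕ) : ℝ) * (16 / 15) = ((16 : ℕ) : ℝ) * 1 by norm_num,
      Real.exp_nat_mul]
    calc Real.exp 1 ^ 16 ≤ (2.72 : ℝ) ^ 16 :=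
          pow_le_pow_left₀ (Real.exp_nonneg _) (by linarith [Real.exp_one_lt_d9]) _
      _ ≤ 3 ^ 15 := by norm_num
  exact le_of_pow_le_pow_left₀ (by norm_num) (by norm_num) h

theorem exp_le_prod {l : ℕ} {S : Fin l → ℝ} {a : ℝ} (ha : 0 < a) (q : Fin l → Prop)
    [DecidablePred q] (hq : ∀ r, q r → 2 * a ≤ S r ^ 2)
    (h : l ≤ 2 * (Finset.univ.filter q).card) :
    ENNReal.ofReal (Real.exp (8 / 15 * l)) ≤ ∏ r, ENNReal.ofReal (1 + S r ^ 2 / a) := by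
  rw [← ENNReal.ofReal_prod_of_nonneg fun r _ => by positivity]
  refine ENNReal.ofReal_le_ofReal ?_
  set m := (Finset.univ.filter q).card with hm
  calc Real.exp (8 / 15 * l) ≤ Real.exp (m * (16 / 15)) := by
        have : (l : ℝ) ≤ 2 * m := by exact_mod_cast h
        exact Real.exp_le_exp.2 (by linarith)
    _ = Real.exp (16 / 15) ^ m := Real.exp_nat_mul _ _
    _ ≤ 3 ^ m := pow_le_pow_left₀ (Real.exp_nonneg _) exp_le_three _
    _ = ∏ r, if q r then (3 : ℝ) else 1 := by
        rw [← Finset.prod_filter, Finset.prod_const]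
    _ ≤ _ := by
        refine Finset.prod_le_prod (fun r _ => by split_ifs <;> norm_num) fun r _ => ?_
        split_ifs with hr
        · have : 2 ≤ S r ^ 2 / a := by
            rw [le_div_iff₀ ha]
            exact hq r hr
          linarith
        · have : 0 ≤ S r ^ 2 / a := by positivity
          linarith

theorem sum_groupTimes {𝒳 : Type*} {K N : ℕ} {M : Type*} [AddCommMonoid M] (G : Grouping N)
    (p : Path 𝒳 K N) (r t : ℕ) (f : Fin N → ℕ → M) :
    ∑ j, ∑ s ∈ groupTimes G p j r t, f j s = ∑ s ∈ Finset.range t,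
      if G.group t p.expert (s + 1) = r then f (p.expert (s + 1)) (s + 1) else 0 := by
  rw [← sum_times p.expert t fun j s => if G.group t p.expert s = r then f j s else 0]
  simp only [groupTimes, Finset.sum_filter]

theorem le_groupSize {𝒳 : Type*} {K N : ℕ} (G : Grouping N) (p : Path 𝒳 K N) {r t : ℕ}
    (hr : r < numGroups t) : (t : ℝ) / numGroups t - N ≤ groupSize G p r t := by
  have hl : (0 : ℝ) < numGroups t := by exact_mod_cast (Nat.zero_le r).trans_lt hr
  have hsum : ∑ j, ((times p.expert j t).card : ℝ) = t := by
    have := sum_times p.expert t fun _ _ => (1 : ℝ)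
    simpa using this
  unfold groupSize
  push_cast
  calc (t : ℝ) / numGroups t - N
      = ∑ j, (((times p.expert j t).card : ℝ) / numGroups t - 1) := by
        rw [Finset.sum_sub_distrib, ← Finset.sum_div, hsum]
        simp
    _ ≤ _ := Finset.sum_le_sum fun j _ => by
        have h1 := G.balanced t p.expert j r hr
        have h2 := Nat.lt_mul_div_succ (times p.expert j t).card
          ((Nat.zero_le r).trans_lt hr)
        have h3 : ((times p.expert j t).card / numGroups t + 1 : ℕ) ≤
            (groupTimes G p j r t).card + 1 := Nat.succ_le_succ h1
        have h4 : ((times p.expert j t).card : ℝ) <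
            numGroups t * ((times p.expert j t).card / numGroups t + 1 : ℕ) := by
          exact_mod_cast h2
        have h5 : (((times p.expert j t).card / numGroups t + 1 : ℕ) : ℝ) ≤
            (groupTimes G p j r t).card + 1 := by exact_mod_cast h3
        rw [sub_le_iff_le_add, div_le_iff₀ hl]
        nlinarith

/-- The time from which on every group has nearly its share of the samples. -/
def MomLarge (N t : ℕ) : Prop := 2 ≤ t ∧ 160 * N * Real.log t ≤ t

theorem MomLarge.numGroups_pos {N t : ℕ} (h : MomLarge N t) : 0 < numGroups t := by
  have h2 : Real.log 2 ≤ Real.log t := Real.log_le_log two_pos (by exact_mod_cast h.1)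
  have : (0 : ℝ) < numGroups t := by
    linarith [sub_one_lt_numGroups (t := t), Real.log_two_gt_d9]
  exact_mod_cast this

theorem MomLarge.le_groupSize {𝒳 : Type*} {K N t : ℕ} (h : MomLarge N t) (G : Grouping N)
    (p : Path 𝒳 K N) {r : ℕ} (hr : r < numGroups t) :
    9 / 10 * (t / numGroups t) ≤ (groupSize G p r t : ℝ) := by
  have hl : (0 : ℝ) < numGroups t := by exact_mod_cast h.numGroups_pos
  have h1 := StochasticExperts.le_groupSize G p hr
  have h2 : (N : ℝ) ≤ 1 / 10 * (t / numGroups t) := by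
    rw [mul_div_assoc', le_div_iff₀ hl]
    have := mul_le_mul_of_nonneg_left (numGroups_le (t := t)) (Nat.cast_nonneg (α := ℝ) N)
    linarith [h.2]
  linarith

theorem MomLarge.momDefined {𝒳 : Type*} {K N t : ℕ} (h : MomLarge N t) (G : Grouping N)
    (p : Path 𝒳 K N) : MomDefined G p t := by
  refine ⟨h.numGroups_pos, fun r hr => ?_⟩
  have hl : (0 : ℝ) < numGroups t := by exact_mod_cast h.numGroups_pos
  have ht : (0 : ℝ) < t := by exact_mod_cast (by linarith [h.1] : 0 < t)
  have : (0 : ℝ) < groupSize G p r t := lt_of_lt_of_le (by positivity) (h.le_groupSize G p hr)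
  exact_mod_cast this

theorem exists_forall_momLarge (N : ℕ) : ∃ t₀ : ℕ, ∀ t, t₀ ≤ t → MomLarge N t := by
  have h1 : (fun x : ℝ => 160 * N * Real.log x) =o[Filter.atTop] fun x => x :=
    Real.isLittleO_log_id_atTop.const_mul_left _
  have h2 := tendsto_natCast_atTop_atTop.eventually (h1.bound (c := 1) one_pos)
  obtain ⟨t₀, h⟩ := Filter.eventually_atTop.1 (h2.and (Filter.eventually_ge_atTop 2))
  refine ⟨t₀, fun t ht => ⟨(h t ht).2, ?_⟩⟩
  have := (le_abs_self _).trans (h t ht).1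
  simpa using this

section GroupW

variable {𝒳 : Type*} [MeasurableSpace 𝒳] {K N : ℕ} (E : Env 𝒳 K N) (G : Grouping N)
  (p : Path 𝒳 K N)

theorem le_groupW (hdiv : ∀ i j, E.FiniteDiv Env.fChi i j) (k : Fin N) (r t : ℕ) :
    groupSize G p r t / E.chiDivMax ≤ groupW E G p k r t := by
  unfold groupSize groupW
  push_cast
  rw [Finset.sum_div]
  exact Finset.sum_le_sum fun j _ => div_le_div_of_nonneg_left (Nat.cast_nonneg _)
    (by linarith [E.one_le_chiDiv (hdiv k j)]) (E.chiDiv_le_chiDivMax k j)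

theorem le_minW (hdiv : ∀ i j, E.FiniteDiv Env.fChi i j) (k : Fin N) {t : ℕ}
    (hdef : MomDefined G p t) : 1 / E.chiDivMax ≤ minW E G p k t := by
  have : Nonempty (Fin (numGroups t)) := ⟨⟨0, hdef.1⟩⟩
  refine le_ciInf fun r => ?_
  have hn : (0 : ℝ) < groupSize G p r t := by exact_mod_cast hdef.2 r r.2
  rw [le_div_iff₀ hn]
  refine le_trans (le_of_eq ?_) (le_groupW E G p hdiv k r t)
  ring

theorem minW_mul_le (k : Fin N) {t : ℕ} (hdef : MomDefined G p t) (r : Fin (numGroups t)) :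
    minW E G p k t * groupSize G p r t ≤ groupW E G p k r t := by
  have hn : (0 : ℝ) < groupSize G p r t := by exact_mod_cast hdef.2 r r.2
  rw [← le_div_iff₀ hn]
  exact ciInf_le (Set.finite_range _).bddBelow r

end GroupW

namespace Run

variable {𝒳 : Type*} [MeasurableSpace 𝒳] {K N : ℕ} {E : Env 𝒳 K N}
  {Ω : Type*} [mΩ : MeasurableSpace Ω] (run : Run E Ω) (G : Grouping N)

/-- The sum of the centred terms of the samples in group `r` at time `t`. -/
noncomputable def momSum (k : Fin N) (t r : ℕ) (ω : Ω) : ℝ :=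
  run.groupSum (E.chiTerm k) (fun s ω => G.group t (fun u => run.expert u ω) s) t r ω

theorem groupMean_sub (k : Fin N) {t r : ℕ} {ω : Ω} (hW : 0 < groupW E G (run.path ω) k r t) :
    groupMean E G (run.path ω) k t r - E.mean k =
      run.momSum G k t r ω / groupW E G (run.path ω) k r t := by
  rw [eq_div_iff hW.ne', sub_mul, groupMean, mul_comm (1 / _), mul_one_div,
    div_mul_cancel₀ _ hW.ne', groupW]
  have h1 : ∀ j, ((groupTimes G (run.path ω) j r t).card : ℝ) / E.chiDiv k j =
      ∑ s ∈ groupTimes G (run.path ω) j r t, 1 / E.chiDiv k j := fun j => by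
    rw [Finset.sum_const, nsmul_eq_mul, mul_one_div]
  simp only [h1]
  rw [Finset.mul_sum]
  simp only [Finset.mul_sum]
  rw [← Finset.sum_sub_distrib]
  simp only [← Finset.sum_sub_distrib]
  rw [sum_groupTimes]
  unfold momSum groupSum
  refine Finset.sum_congr rfl fun s _ => ?_
  congr 1
  simp only [path, sampleRatio, Env.chiTerm, Env.obs, step]
  ring

/-- The event that the product of the quadratic potentials of the groups is large. -/
def momBad (k : Fin N) (t : ℕ) : Set Ω :=
  {ω | ENNReal.ofReal (Real.exp (8 / 15 * numGroups t)) ≤ ∏ r : Fin (numGroups t),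
    ENNReal.ofReal (1 + run.momSum G k t r ω ^ 2 / (3 * t / numGroups t))}

theorem measure_momBad_le (hdiv : ∀ i j, E.FiniteDiv Env.fChi i j) (k : Fin N) {t : ℕ}
    (ht : 0 < t) (hl : 0 < numGroups t) :
    run.law (run.momBad G k t) ≤ ENNReal.ofReal (2 * (1 / (t : ℝ) ^ 2)) := by
  have ht' : (0 : ℝ) < t := by exact_mod_cast ht
  have hl' : (0 : ℝ) < numGroups t := by exact_mod_cast hl
  set l := numGroups t with hldef
  set a : ℝ := 3 * t / l with ha
  have ha0 : 0 < a := by positivity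
  have hlogt := Real.log_nonneg (show (1 : ℝ) ≤ t by exact_mod_cast ht)
  have hg := fun s => run.measurable_group G t s
  have hψ : Measurable fun x : ℝ => ENNReal.ofReal (1 + x ^ 2 / a) := by fun_prop
  have h1 := run.lintegral_prod_groupSum_le (E.measurable_chiTerm k)
    (g := fun s ω => G.group t (fun u => run.expert u ω) s) hg hψ (by simp)
    (fun j S => E.lintegral_one_add_sq_le (hdiv k j) ha0 S) (l := l)
    (fun s ω => G.group_lt t _ s hl) t
  have hm : Measurable fun ω => ∏ r : Fin l, ENNReal.ofReal (1 + run.momSum G k t r ω ^ 2 / a) :=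
    Finset.measurable_fun_prod _ fun r _ => hψ.comp
      ((run.measurable_groupSum (E.measurable_chiTerm k) hg t r).mono (run.ℱ.le t) le_rfl)
  refine (meas_ge_le_lintegral_div hm.aemeasurable (by simp [Real.exp_pos])
    ENNReal.ofReal_ne_top).trans ((ENNReal.div_le_div_right h1 _).trans ?_)
  rw [← ENNReal.ofReal_pow (by positivity), ← ENNReal.ofReal_div_of_pos (Real.exp_pos _)]
  refine ENNReal.ofReal_le_ofReal ?_
  have h2 : (1 + 1 / a) ^ t ≤ Real.exp (l / 3) := by
    calc (1 + 1 / a) ^ t ≤ Real.exp (1 / a) ^ t :=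
          pow_le_pow_left₀ (by positivity) (by linarith [Real.add_one_le_exp (1 / a)]) _
      _ = Real.exp (t * (1 / a)) := (Real.exp_nat_mul _ _).symm
      _ = Real.exp (l / 3) := by
          congr 1
          rw [ha]
          field_simp
  have h3 : Real.exp (1 / 5) ≤ 2 := by
    have : Real.exp (1 / 5) ≤ Real.exp (Real.log 2) :=
      Real.exp_le_exp.2 (by linarith [Real.log_two_gt_d9])
    rwa [Real.exp_log two_pos] at this
  calc (1 + 1 / a) ^ t / Real.exp (8 / 15 * l) ≤ Real.exp (l / 3) / Real.exp (8 / 15 * l) := by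
        gcongr
    _ = Real.exp (-(l / 5)) := by
        rw [← Real.exp_sub]
        ring_nf
    _ ≤ Real.exp (1 / 5 + -(2 * Real.log t)) :=
        Real.exp_le_exp.2 (by linarith [sub_one_lt_numGroups (t := t)])
    _ = Real.exp (1 / 5) * (1 / (t : ℝ) ^ 2) := by
        rw [Real.exp_add, Real.exp_neg, two_mul, Real.exp_add, Real.exp_log ht',
          one_div ((t : ℝ) ^ 2), sq]
    _ ≤ _ := mul_le_mul_of_nonneg_right h3 (by positivity)

theorem abs_momMean_sub_le (hdiv : ∀ i j, E.FiniteDiv Env.fChi i j) (k : Fin N) {t : ℕ}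
    (ht : MomLarge N t) {ω : Ω} (hgood : ω ∉ run.momBad G k t) :
    |momMean E G (run.path ω) k t - E.mean k| ≤
      1 / minW E G (run.path ω) k t * Real.sqrt (64 * Real.log (1 / (1 / (t : ℝ) ^ 2)) / t) := by
  classical
  have ht0 : (0 : ℝ) < t := by exact_mod_cast (by linarith [ht.1] : 0 < t)
  have hl : (0 : ℝ) < numGroups t := by exact_mod_cast ht.numGroups_pos
  have hdef := ht.momDefined G (run.path ω)
  have hσ : 1 ≤ E.chiDivMax := (E.one_le_chiDiv (hdiv k k)).trans (E.chiDiv_le_chiDivMax k k)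
  have hminW : 0 < minW E G (run.path ω) k t :=
    lt_of_lt_of_le (by positivity) (le_minW E G (run.path ω) hdiv k hdef)
  set q := Real.sqrt (64 * Real.log (1 / (1 / (t : ℝ) ^ 2)) / t) with hq
  refine abs_median_sub_le _ _ _ ?_
  by_contra! hcard
  refine hgood (exp_le_prod (by positivity) _ (fun r hr => ?_) hcard)
  have hn := ht.le_groupSize G (run.path ω) r.2
  have hn0 : (0 : ℝ) < groupSize G (run.path ω) r t := lt_of_lt_of_le (by positivity) hn
  have hWn := minW_mul_le E G (run.path ω) k hdef r
  have hW : 0 < groupW E G (run.path ω) k r t := lt_of_lt_of_le (by positivity) hWn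
  rw [run.groupMean_sub G k hW, abs_div, abs_of_pos hW, lt_div_iff₀ hW] at hr
  have hq0 : 0 ≤ q := Real.sqrt_nonneg _
  have h1 : groupSize G (run.path ω) r t * q ≤ |run.momSum G k t r ω| := by
    refine le_trans ?_ hr.le
    calc groupSize G (run.path ω) r t * q
        = 1 / minW E G (run.path ω) k t * q *
          (minW E G (run.path ω) k t * groupSize G (run.path ω) r t) := by
          field_simp
      _ ≤ _ := mul_le_mul_of_nonneg_left hWn (by positivity)
  have h2 : 9 / 10 * (t / numGroups t) * q ≤ |run.momSum G k t r ω| :=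
    (mul_le_mul_of_nonneg_right hn hq0).trans h1
  have h3 := pow_le_pow_left₀ (by positivity) h2 2
  rw [sq_abs] at h3
  refine le_trans ?_ h3
  have hq2 : 8 * numGroups t / t ≤ q ^ 2 := by
    rw [hq, Real.sq_sqrt (by
      rw [log_one_div_one_div_sq]
      have := Real.log_natCast_nonneg t
      positivity), log_one_div_one_div_sq]
    exact div_le_div_of_nonneg_right (by linarith [numGroups_le (t := t)]) ht0.le
  calc 2 * (3 * t / (numGroups t : ℝ)) ≤
        (9 / 10 * (t / numGroups t)) ^ 2 * (8 * numGroups t / t) := by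
        have : (9 / 10 * (t / numGroups t)) ^ 2 * (8 * numGroups t / t) =
          6.48 * ((t : ℝ) / numGroups t) := by
          field_simp
          norm_num
        rw [this, mul_div_assoc]
        have : 0 < (t : ℝ) / numGroups t := by positivity
        linarith
    _ ≤ _ := by
        rw [mul_pow _ q]
        exact mul_le_mul_of_nonneg_left hq2 (by positivity)

theorem gap_le_of_momUCB (hdiv : ∀ i j, E.FiniteDiv Env.fChi i j) (hN : 2 ≤ N) {t T : ℕ}
    (ht : MomLarge N t) (htT : t ≤ T) {ω : Ω}
    (hucb : ∀ j, momUCB E G (run.path ω) j t ≤ momUCB E G (run.path ω) (run.expert (t + 1) ω) t)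
    (hgood : ∀ k, ω ∉ run.momBad G k t) :
    E.gap (run.expert (t + 1) ω) ≤ Real.sqrt (512 * E.chiDivMax ^ 2 * Real.log T / t) := by
  have ht0 : (0 : ℝ) < t := by exact_mod_cast (by linarith [ht.1] : 0 < t)
  set k := run.expert (t + 1) ω with hk
  have hlogT : Real.log t ≤ Real.log T := Real.log_le_log ht0 (by exact_mod_cast htT)
  have hσ : 1 ≤ E.chiDivMax := (E.one_le_chiDiv (hdiv k k)).trans (E.chiDiv_le_chiDivMax k k)
  have hminW := le_minW E G (run.path ω) hdiv k (ht.momDefined G (run.path ω))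
  obtain ⟨o, ho⟩ := E.exists_gap_eq_zero (by omega)
  have h1 := (abs_le.1 (run.abs_momMean_sub_le G hdiv o ht (hgood o))).1
  have h2 := (abs_le.1 (run.abs_momMean_sub_le G hdiv k ht (hgood k))).2
  have h3 := hucb o
  unfold momUCB at h3
  set q := Real.sqrt (64 * Real.log (1 / (1 / (t : ℝ) ^ 2)) / t) with hq
  have h4 : 1 / minW E G (run.path ω) k t * q ≤ E.chiDivMax * q := by
    refine mul_le_mul_of_nonneg_right ?_ (Real.sqrt_nonneg _)
    rw [one_div]
    exact inv_le_of_inv_le₀ (by positivity) (by simpa using hminW)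
  have h5 : E.gap k ≤ 2 * (E.chiDivMax * q) := by
    unfold Env.gap at ho ⊢
    linarith
  refine Real.le_sqrt_of_sq_le ((pow_le_pow_left₀ (E.gap_nonneg k) h5 2).trans ?_)
  have := Real.log_natCast_nonneg t
  rw [mul_pow, mul_pow, hq, log_one_div_one_div_sq, Real.sq_sqrt (by positivity)]
  calc 2 ^ 2 * (E.chiDivMax ^ 2 * (64 * (2 * Real.log t) / t)) =
        512 * E.chiDivMax ^ 2 * Real.log t / t := by ring
    _ ≤ _ := by gcongr

theorem regret_le_of_isMomUCB (hucb : run.IsMomUCB G) (hdiv : ∀ i j, E.FiniteDiv Env.fChi i j)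
    (hN : 2 ≤ N) {d : ℝ} (hd : 0 < d) (hgap : E.sortedGap 2 = d) {t₀ : ℕ}
    (ht₀ : ∀ t, t₀ ≤ t → MomLarge N t) (T : ℕ) :
    run.regret T ≤ t₀ + 4 * N + 2 * (512 * E.chiDivMax ^ 2 * Real.log T) / d := by
  have hlogT : 0 ≤ Real.log T := Real.log_natCast_nonneg T
  have := run.regret_le hN hd hgap (A := 512 * E.chiDivMax ^ 2 * Real.log T) (by positivity)
    (c := 2 * N) (by positivity) t₀ T fun t ht htT => ?_
  · linarith
  have hlarge := ht₀ t ht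
  refine ⟨⋃ k : Fin N, run.momBad G k t, ?_, ?_⟩
  · calc _ ≤ ∑ k : Fin N, run.law (run.momBad G k t) := measure_iUnion_fintype_le _ _
      _ ≤ ∑ k : Fin N, ENNReal.ofReal (2 * (1 / (t : ℝ) ^ 2)) := Finset.sum_le_sum fun k _ =>
          run.measure_momBad_le G hdiv k (by linarith [hlarge.1]) hlarge.numGroups_pos
      _ = ENNReal.ofReal (N * (2 * (1 / (t : ℝ) ^ 2))) := by
          rw [ENNReal.ofReal_mul (by positivity : (0 : ℝ) ≤ N)]
          simp
      _ = _ := by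
          congr 1
          ring
  · filter_upwards [hucb] with ω h1 hω
    simp only [Set.mem_iUnion, not_exists] at hω
    exact run.gap_le_of_momUCB G hdiv hN hlarge htT.le
      (h1 t (hlarge.momDefined G (run.path ω))) hω

end Run

end StochasticExperts

namespace StochasticExperts

open scoped ENNReal NNReal

/-! ### The expectation of `λ` under the generative model -/

/-- The points `x` such that `x i` exceeds `d` and every other smaller coordinate by more than the
factor `1 / s`. -/
def isolated {n : ℕ} (d s : ℝ) (i : Fin n) : Set (Fin n → ℝ) :=
  {x | d < s * x i ∧ ∀ j, j ≠ i → x j ∉ Set.Ioo (s * x i) (x i)}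

theorem measurableSet_isolated_prod {n : ℕ} (d : ℝ) (i : Fin n) :
    MeasurableSet {p : (Fin n → ℝ) × ℝ | p.1 ∈ isolated d p.2 i} := by
  have e : {p : (Fin n → ℝ) × ℝ | p.1 ∈ isolated d p.2 i} = {p | d < p.2 * p.1 i} ∩
      ⋂ j, ⋂ (_ : j ≠ i), ({p | p.2 * p.1 i < p.1 j} ∩ {p | p.1 j < p.1 i})ᶜ := by
    ext p
    simp [isolated]
  have h : ∀ j, Measurable fun p : (Fin n → ℝ) × ℝ => p.1 j := fun j =>
    (measurable_pi_apply j).comp measurable_fst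
  have h' : Measurable fun p : (Fin n → ℝ) × ℝ => p.2 * p.1 i := measurable_snd.mul (h i)
  rw [e]
  exact (measurableSet_lt measurable_const h').inter (MeasurableSet.iInter fun j =>
    MeasurableSet.iInter fun _ => ((measurableSet_lt h' (h j)).inter
      (measurableSet_lt (h j) (h i))).compl)

theorem measurableSet_isolated {n : ℕ} (d s : ℝ) (i : Fin n) :
    MeasurableSet (isolated d s i) :=
  measurable_prodMk_right (y := s) (measurableSet_isolated_prod d i)

/-- The uniform law on `[d, 1]`. -/
noncomputable def unifLaw (d : ℝ) : Measure ℝ := ProbabilityTheory.cond volume (Set.Icc d 1)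

theorem isProbabilityMeasure_unifLaw {d : ℝ} (hd : d < 1) : IsProbabilityMeasure (unifLaw d) :=
  cond_isProbabilityMeasure_of_finite (by simp [hd]) (by simp)

theorem unifLaw_eq (d : ℝ) :
    unifLaw d = (ENNReal.ofReal (1 - d))⁻¹ • volume.restrict (Set.Icc d 1) := by
  rw [unifLaw, ProbabilityTheory.cond, Real.volume_Icc]

theorem ae_unifLaw_mem (d : ℝ) : ∀ᵐ y ∂(unifLaw d), y ∈ Set.Icc d 1 := by
  rw [unifLaw_eq]
  exact Measure.ae_smul_measure (ae_restrict_mem measurableSet_Icc) _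

theorem unifLaw_compl_Ioo {d : ℝ} (hd1 : d < 1) {a y : ℝ} (ha : d ≤ a) (hy : y ≤ 1) (hay : a ≤ y) :
    unifLaw d (Set.Ioo a y)ᶜ = ENNReal.ofReal (1 - (y - a) / (1 - d)) := by
  have := isProbabilityMeasure_unifLaw hd1
  have hL : 0 < 1 - d := by linarith
  have hsub : Set.Ioo a y ⊆ Set.Icc d 1 := fun z hz => ⟨ha.trans hz.1.le, hz.2.le.trans hy⟩
  rw [prob_compl_eq_one_sub measurableSet_Ioo, unifLaw_eq, Measure.smul_apply,
    Measure.restrict_apply measurableSet_Ioo, Set.inter_eq_self_of_subset_left hsub,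
    Real.volume_Ioo, smul_eq_mul,
    mul_comm, ← div_eq_mul_inv, ← ENNReal.ofReal_div_of_pos hL,
    ENNReal.ofReal_sub _ (div_nonneg (by linarith) hL.le), ENNReal.ofReal_one]

theorem integral_pow_sub_mul {d s : ℝ} (hd1 : d < 1) (hs1 : s < 1) (m : ℕ) (a : ℝ) :
    ∫ y in a..1, 1 / (1 - d) * (1 - (1 - s) * y / (1 - d)) ^ m =
      ((1 - (1 - s) * a / (1 - d)) ^ (m + 1) - (1 - (1 - s) * 1 / (1 - d)) ^ (m + 1)) /
        ((m + 1) * (1 - s)) := by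
  have hL : 1 - d ≠ 0 := by linarith
  have hs : 1 - s ≠ 0 := by linarith
  have hm : (m + 1 : ℝ) ≠ 0 := by positivity
  have hderiv : ∀ y ∈ Set.uIcc a 1, HasDerivAt
      (fun y => -((1 - (1 - s) * y / (1 - d)) ^ (m + 1) / ((m + 1) * (1 - s))))
      (1 / (1 - d) * (1 - (1 - s) * y / (1 - d)) ^ m) y := by
    intro y _
    have h1 : HasDerivAt (fun y : ℝ => 1 - (1 - s) * y / (1 - d)) (-((1 - s) * 1 / (1 - d))) y :=
      (((hasDerivAt_id y).const_mul (1 - s)).div_const _).const_sub 1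
    have h2 := ((h1.pow (m + 1)).div_const ((m + 1) * (1 - s))).neg
    refine h2.congr_deriv ?_
    rw [Nat.add_sub_cancel]
    push_cast
    field_simp
  rw [intervalIntegral.integral_eq_sub_of_hasDerivAt hderiv
    (Continuous.intervalIntegrable (by fun_prop) _ _)]
  ring

theorem pi_isolated_le {m : ℕ} {d s : ℝ} (hd0 : 0 < d) (hd1 : d < 1) (hs0 : 0 < s) (hs1 : s < 1)
    (i : Fin (m + 1)) :
    Measure.pi (fun _ => unifLaw d) (isolated d s i) ≤
      ENNReal.ofReal ((∑ j ∈ Finset.range (m + 1), s ^ j) / (m + 1)) := by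
  have := isProbabilityMeasure_unifLaw hd1
  have hL : 0 < 1 - d := by linarith
  have hs' : 0 < 1 - s := by linarith
  set D : Set (ℝ × (Fin m → ℝ)) := {p | d < s * p.1 ∧ ∀ j, p.2 j ∉ Set.Ioo (s * p.1) p.1} with hD
  have hmp := measurePreserving_piFinSuccAbove (fun _ : Fin (m + 1) => unifLaw d) i
  have hpre : isolated d s i =
      (MeasurableEquiv.piFinSuccAbove (fun _ : Fin (m + 1) => ℝ) i) ⁻¹' D := by
    ext x
    simp only [isolated, hD, Set.mem_preimage, Set.mem_ofPred_eq]
    refine and_congr Iff.rfl ⟨fun h j => h _ (Fin.succAbove_ne i j), fun h j hj => ?_⟩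
    obtain ⟨j', rfl⟩ := Fin.exists_succAbove_eq hj
    exact h j'
  have hDm : MeasurableSet D := by
    have e : D = {p | d < s * p.1} ∩
        ⋂ j, ({p | s * p.1 < p.2 j} ∩ {p | p.2 j < p.1})ᶜ := by
      ext p
      simp [hD]
    have h : ∀ j, Measurable fun p : ℝ × (Fin m → ℝ) => p.2 j := fun j =>
      (measurable_pi_apply j).comp measurable_snd
    have h' : Measurable fun p : ℝ × (Fin m → ℝ) => s * p.1 := measurable_fst.const_mul s
    rw [e]
    exact (measurableSet_lt measurable_const h').inter (MeasurableSet.iInter fun j =>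
      ((measurableSet_lt h' (h j)).inter (measurableSet_lt (h j) measurable_fst)).compl)
  rw [hpre, hmp.measure_preimage hDm.nullMeasurableSet, Measure.prod_apply hDm]
  have hbound : ∀ᵐ y ∂(unifLaw d), Measure.pi (fun _ : Fin m => unifLaw d) (Prod.mk y ⁻¹' D) ≤
      (Set.Ioc (d / s) 1).indicator
        (fun y => ENNReal.ofReal ((1 - (1 - s) * y / (1 - d)) ^ m)) y := by
    filter_upwards [ae_unifLaw_mem d] with y hy
    by_cases hdy : d < s * y
    · have hy0 : 0 < y := hd0.trans_le hy.1
      have hmem : y ∈ Set.Ioc (d / s) 1 := ⟨by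
        rw [div_lt_iff₀ hs0]
        linarith, hy.2⟩
      rw [Set.indicator_of_mem hmem]
      have : Prod.mk y ⁻¹' D = Set.univ.pi fun _ => (Set.Ioo (s * y) y)ᶜ := by
        ext w
        simp only [hD, Set.mem_preimage, Set.mem_ofPred_eq, Set.mem_univ_pi, Set.mem_compl_iff]
        exact and_iff_right hdy
      have hnn : 0 ≤ 1 - (y - s * y) / (1 - d) := by
        rw [sub_nonneg, div_le_one hL]
        linarith [hy.2]
      rw [this, Measure.pi_pi, unifLaw_compl_Ioo hd1 hdy.le hy.2 (by nlinarith),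
        Finset.prod_const, Finset.card_univ, Fintype.card_fin, ← ENNReal.ofReal_pow hnn]
      exact le_of_eq (by ring_nf)
    · have : Prod.mk y ⁻¹' D = ∅ := by
        ext w
        simp [hD, hdy]
      simp [this]
  refine (lintegral_mono_ae hbound).trans ?_
  rw [unifLaw_eq, lintegral_smul_measure, lintegral_indicator measurableSet_Ioc,
    Measure.restrict_restrict measurableSet_Ioc]
  by_cases hds : d / s ≤ 1
  · have hds' : d ≤ s := by rwa [div_le_one hs0] at hds
    have hsub : Set.Ioc (d / s) 1 ∩ Set.Icc d 1 = Set.Ioc (d / s) 1 :=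
      Set.inter_eq_self_of_subset_left fun y hy => ⟨by
        have : d ≤ d / s := le_div_self hd0.le hs0 hs1.le
        linarith [hy.1], hy.2⟩
    have hnn : ∀ y ∈ Set.Ioc (d / s) 1, 0 ≤ (1 - (1 - s) * y / (1 - d)) ^ m := fun y hy => by
      refine pow_nonneg ?_ _
      rw [sub_nonneg, div_le_one hL]
      nlinarith [hy.2]
    have hint : IntervalIntegrable (fun y => 1 / (1 - d) * (1 - (1 - s) * y / (1 - d)) ^ m) volume
      (d / s) 1 := Continuous.intervalIntegrable (by fun_prop) _ _
    rw [hsub, smul_eq_mul, ← ENNReal.ofReal_inv_of_pos hL, ← lintegral_const_mul _ (by fun_prop)]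
    simp only [← one_div (1 - d), ← ENNReal.ofReal_mul (one_div_nonneg.2 hL.le)]
    rw [← ofReal_integral_eq_lintegral_ofReal
      ((intervalIntegrable_iff_integrableOn_Ioc_of_le hds).1 hint)
      ((ae_restrict_mem measurableSet_Ioc).mono fun y hy =>
        mul_nonneg (by positivity) (hnn y hy)),
      ← intervalIntegral.integral_of_le hds, integral_pow_sub_mul hd1 hs1]
    refine ENNReal.ofReal_le_ofReal ?_
    set q := (s - d) / (s * (1 - d)) with hq
    have hq0 : 0 ≤ q := div_nonneg (by linarith) (by positivity)
    have hq1 : q ≤ 1 := by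
      rw [hq, div_le_one (by positivity)]
      nlinarith
    have e1 : 1 - (1 - s) * (d / s) / (1 - d) = q := by
      rw [hq]
      field_simp
      ring
    have e2 : 1 - (1 - s) * 1 / (1 - d) = s * q := by
      rw [hq]
      field_simp
      ring
    have e3 : (∑ j ∈ Finset.range (m + 1), s ^ j) * (1 - s) = 1 - s ^ (m + 1) :=
      geom_sum_mul_neg s (m + 1)
    rw [e1, e2, mul_pow, div_le_div_iff₀ (by positivity) (by positivity)]
    have e4 : q ^ (m + 1) ≤ 1 := pow_le_one₀ hq0 hq1
    have e5 : 0 ≤ 1 - s ^ (m + 1) := sub_nonneg.2 (pow_le_one₀ hs0.le hs1.le)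
    calc (q ^ (m + 1) - s ^ (m + 1) * q ^ (m + 1)) * (m + 1)
        = q ^ (m + 1) * ((1 - s ^ (m + 1)) * (m + 1)) := by ring
      _ ≤ 1 * ((1 - s ^ (m + 1)) * (m + 1)) :=
        mul_le_mul_of_nonneg_right e4 (by positivity)
      _ = _ := by
        rw [← e3]
        ring
  · rw [Set.Ioc_eq_empty (by linarith)]
    simp

/-- The sum in `λ` as a function of the gaps which are not the two smallest ones. -/
noncomputable def lamSum (d : ℝ) {n : ℕ} (x : Fin n → ℝ) : ℝ :=
  ∑ m ∈ Finset.range n, (1 - (if m = 0 then d else orderStat x m) ^ 2 / orderStat x (m + 1) ^ 2)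

theorem measurable_lamSum (d : ℝ) (n : ℕ) : Measurable fun x : Fin n → ℝ => lamSum d x := by
  refine Finset.measurable_fun_sum _ fun m hm => ?_
  have hm := Finset.mem_range.1 hm
  refine measurable_const.sub (Measurable.div (Measurable.pow_const ?_ 2)
    ((measurable_orderStat (by omega) (by omega)).pow_const 2))
  by_cases h0 : m = 0
  · simp only [h0, if_true]
    exact measurable_const
  · simp only [h0, if_false]
    exact measurable_orderStat (by omega) (by omega)

theorem prev_mem {d : ℝ} {n : ℕ} {x : Fin n → ℝ} (hx : ∀ i, d ≤ x i) {m : ℕ} (hm : m < n) :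
    (if m = 0 then d else orderStat x m) ∈ Set.Icc d (orderStat x (m + 1)) := by
  have h : ∀ m < n, d ≤ orderStat x (m + 1) := fun m hm => by
    rw [orderStat_succ x hm]
    exact hx _
  split_ifs with h0
  · exact ⟨le_rfl, h m hm⟩
  · obtain ⟨m, rfl⟩ := Nat.exists_eq_succ_of_ne_zero h0
    exact ⟨h m (by omega), orderStat_mono x (by omega) (by omega) (by omega)⟩

theorem one_sub_sq_div_mem {a y : ℝ} (ha : 0 < a) (hay : a ≤ y) :
    1 - a ^ 2 / y ^ 2 ∈ Set.Icc (0 : ℝ) 1 := by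
  have hy : 0 < y := ha.trans_le hay
  constructor
  · rw [sub_nonneg, div_le_one (by positivity)]
    exact pow_le_pow_left₀ ha.le hay 2
  · have : 0 ≤ a ^ 2 / y ^ 2 := by positivity
    linarith

theorem lamSum_mem {d : ℝ} (hd : 0 < d) {n : ℕ} {x : Fin n → ℝ} (hx : ∀ i, d ≤ x i) :
    lamSum d x ∈ Set.Icc (0 : ℝ) n := by
  have h : ∀ m ∈ Finset.range n, 1 - (if m = 0 then d else orderStat x m) ^ 2 /
      orderStat x (m + 1) ^ 2 ∈ Set.Icc (0 : ℝ) 1 := fun m hm => by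
    have := prev_mem hx (Finset.mem_range.1 hm)
    exact one_sub_sq_div_mem (hd.trans_le this.1) this.2
  refine ⟨Finset.sum_nonneg fun m hm => (h m hm).1, ?_⟩
  calc lamSum d x ≤ ∑ m ∈ Finset.range n, (1 : ℝ) := Finset.sum_le_sum fun m hm => (h m hm).2
    _ = n := by simp

theorem mem_isolated {d s : ℝ} {n : ℕ} {x : Fin n → ℝ} (hx : ∀ i, d ≤ x i) (m : Fin n)
    (h : (if (m : ℕ) = 0 then d else orderStat x m) < s * orderStat x (m + 1)) :
    x ∈ isolated d s (Tuple.sort x m) := by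
  have hp := prev_mem hx m.2
  rw [orderStat_succ x m.2] at h hp
  refine ⟨hp.1.trans_lt h, fun j hj hmem => ?_⟩
  obtain ⟨k, rfl⟩ := (Tuple.sort x).surjective j
  rcases lt_or_gt_of_ne (fun e => hj (congrArg _ e) : k ≠ m) with hkm | hkm
  · have h0 : (m : ℕ) ≠ 0 := by
      have : (k : ℕ) < m := hkm
      omega
    rw [if_neg h0] at h
    have : x (Tuple.sort x k) ≤ orderStat x m := by
      rw [← orderStat_succ x k.2]
      exact orderStat_mono x (by omega) hkm m.2.le
    exact absurd hmem.1 (not_lt.2 (this.trans h.le))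
  · exact absurd hmem.2 (not_lt.2 (Tuple.monotone_sort x hkm.le))

theorem ofReal_one_sub_sq_div {a y : ℝ} (ha : 0 < a) (hay : a ≤ y) :
    ENNReal.ofReal (1 - a ^ 2 / y ^ 2) =
      ∫⁻ s in Set.Ioo (0 : ℝ) 1,
        (Set.Ioi (a / y)).indicator (fun s => ENNReal.ofReal (2 * s)) s := by
  have hy : 0 < y := ha.trans_le hay
  have h1 : a / y ≤ 1 := (div_le_one hy).2 hay
  have h0 : 0 < a / y := by positivity
  have e : Set.Ioi (a / y) ∩ Set.Ioo 0 1 = Set.Ioo (a / y) 1 := by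
    ext s
    simp only [Set.mem_inter_iff, Set.mem_Ioi, Set.mem_Ioo]
    exact ⟨fun h => ⟨h.1, h.2.2⟩, fun h => ⟨h.1, h0.trans h.1, h.2⟩⟩
  rw [lintegral_indicator measurableSet_Ioi, Measure.restrict_restrict measurableSet_Ioi, e,
    restrict_Ioo_eq_restrict_Ioc, ← ofReal_integral_eq_lintegral_ofReal
      ((intervalIntegrable_iff_integrableOn_Ioc_of_le h1).1
        (Continuous.intervalIntegrable (by fun_prop) _ _))
      ((ae_restrict_mem measurableSet_Ioc).mono fun s hs =>
        mul_nonneg two_pos.le (h0.trans hs.1).le),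
    ← intervalIntegral.integral_of_le h1, intervalIntegral.integral_const_mul, integral_id]
  congr 1
  rw [div_pow]
  ring

theorem ofReal_lamSum_le {d : ℝ} (hd : 0 < d) {n : ℕ} {x : Fin n → ℝ} (hx : ∀ i, d ≤ x i) :
    ENNReal.ofReal (lamSum d x) ≤ ∫⁻ s in Set.Ioo (0 : ℝ) 1,
      ∑ i, (isolated d s i).indicator (fun _ => ENNReal.ofReal (2 * s)) x := by
  have hp : ∀ m : Fin n, _ := fun m => prev_mem hx m.2
  rw [lamSum, Finset.sum_range, ENNReal.ofReal_sum_of_nonneg fun m _ =>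
    (one_sub_sq_div_mem (hd.trans_le (hp m).1) (hp m).2).1]
  simp only [fun m => ofReal_one_sub_sq_div (hd.trans_le (hp m).1) (hp m).2]
  rw [← lintegral_finsetSum _ fun m _ => Measurable.indicator (by fun_prop) measurableSet_Ioi]
  refine lintegral_mono fun s => ?_
  rw [← Equiv.sum_comp (Tuple.sort x) fun i =>
    (isolated d s i).indicator (fun _ => ENNReal.ofReal (2 * s)) x]
  refine Finset.sum_le_sum fun m _ => ?_
  by_cases h : s ∈ Set.Ioi ((if (m : ℕ) = 0 then d else orderStat x m) / orderStat x (m + 1))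
  · rw [Set.indicator_of_mem h, Set.indicator_of_mem]
    refine mem_isolated hx m ?_
    rwa [Set.mem_Ioi, div_lt_iff₀ (hd.trans_le ((hp m).1.trans (hp m).2))] at h
  · rw [Set.indicator_of_notMem h]
    exact zero_le

theorem sum_two_div_le (n : ℕ) :
    ∑ m ∈ Finset.range n, 2 / ((m : ℝ) + 2) ≤ 2 * Real.log (n + 1) := by
  induction n with
  | zero => simp
  | succ n ih =>
    rw [Finset.sum_range_succ]
    have h := Real.log_le_sub_one_of_pos (show (0 : ℝ) < (n + 1) / (n + 2) by positivity)
    rw [Real.log_div (by positivity) (by positivity)] at h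
    have e : ((n : ℝ) + 1) / (n + 2) - 1 = -(1 / (n + 2)) := by
      field_simp
      ring
    rw [e] at h
    have e2 : 2 / ((n : ℝ) + 2) = 2 * (1 / (n + 2)) := by ring
    push_cast
    rw [e2, show (n : ℝ) + 1 + 1 = n + 2 by ring]
    linarith

theorem lintegral_lamSum_le {d : ℝ} (hd0 : 0 < d) (hd1 : d < 1) (n : ℕ) :
    ∫⁻ x : Fin n → ℝ, ENNReal.ofReal (lamSum d x) ∂(Measure.pi fun _ => unifLaw d) ≤
      ENNReal.ofReal (2 * Real.log (n + 1)) := by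
  have := isProbabilityMeasure_unifLaw hd1
  rcases n with _ | m
  · simp [lamSum]
  have hx : ∀ᵐ x : Fin (m + 1) → ℝ ∂(Measure.pi fun _ => unifLaw d), ∀ i, d ≤ x i :=
    ae_all_iff.2 fun i => (Measure.quasiMeasurePreserving_eval (fun _ => unifLaw d) i).ae
      ((ae_unifLaw_mem d).mono fun y hy => hy.1)
  have hmeas : Measurable (Function.uncurry fun (x : Fin (m + 1) → ℝ) (s : ℝ) =>
      ∑ i, (isolated d s i).indicator (fun _ => ENNReal.ofReal (2 * s)) x) := by
    refine Finset.measurable_fun_sum _ fun i _ => ?_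
    have : Measurable ({p : (Fin (m + 1) → ℝ) × ℝ | p.1 ∈ isolated d p.2 i}.indicator
        fun p => ENNReal.ofReal (2 * p.2)) :=
      Measurable.indicator (by fun_prop) (measurableSet_isolated_prod d i)
    exact this
  calc _ ≤ ∫⁻ x : Fin (m + 1) → ℝ, (∫⁻ s in Set.Ioo (0 : ℝ) 1, ∑ i, (isolated d s i).indicator
          (fun _ => ENNReal.ofReal (2 * s)) x) ∂(Measure.pi fun _ => unifLaw d) :=
        lintegral_mono_ae (hx.mono fun x hx => ofReal_lamSum_le hd0 hx)
    _ = ∫⁻ s in Set.Ioo (0 : ℝ) 1, ∫⁻ x : Fin (m + 1) → ℝ, ∑ i, (isolated d s i).indicator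
          (fun _ => ENNReal.ofReal (2 * s)) x ∂(Measure.pi fun _ => unifLaw d) :=
        lintegral_lintegral_swap hmeas.aemeasurable
    _ ≤ ∫⁻ s in Set.Ioc (0 : ℝ) 1,
          ENNReal.ofReal (∑ j ∈ Finset.range (m + 1), 2 * s ^ (j + 1)) := by
        rw [← restrict_Ioo_eq_restrict_Ioc]
        refine lintegral_mono_ae ((ae_restrict_mem measurableSet_Ioo).mono fun s hs => ?_)
        rw [lintegral_finsetSum _ fun i _ =>
          measurable_const.indicator (measurableSet_isolated d s i)]
        have hs0 : 0 < s := hs.1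
        calc _ ≤ ∑ i : Fin (m + 1), ENNReal.ofReal (2 * s) *
              ENNReal.ofReal ((∑ j ∈ Finset.range (m + 1), s ^ j) / (m + 1)) := by
              refine Finset.sum_le_sum fun i _ => ?_
              rw [lintegral_indicator_const (measurableSet_isolated d s i)]
              exact mul_le_mul_right (pi_isolated_le hd0 hd1 hs.1 hs.2 i) _
          _ = _ := by
              rw [← ENNReal.ofReal_mul (by positivity), Finset.sum_const, Finset.card_univ,
                Fintype.card_fin, nsmul_eq_mul, ← ENNReal.ofReal_natCast,
                ← ENNReal.ofReal_mul (by positivity)]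
              congr 1
              push_cast
              have : ∑ j ∈ Finset.range (m + 1), 2 * s ^ (j + 1) =
                  2 * s * ∑ j ∈ Finset.range (m + 1), s ^ j := by
                rw [Finset.mul_sum]
                exact Finset.sum_congr rfl fun j _ => by ring
              rw [this]
              field_simp
    _ = ENNReal.ofReal (∑ j ∈ Finset.range (m + 1), 2 / ((j : ℝ) + 2)) := by
        rw [← ofReal_integral_eq_lintegral_ofReal
          ((intervalIntegrable_iff_integrableOn_Ioc_of_le zero_le_one).1
            (Continuous.intervalIntegrable (by fun_prop) _ _))
          ((ae_restrict_mem measurableSet_Ioc).mono fun s hs => Finset.sum_nonneg fun j _ => by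
            have := hs.1
            positivity),
          ← intervalIntegral.integral_of_le zero_le_one, intervalIntegral.integral_finsetSum
            fun j _ => Continuous.intervalIntegrable (by fun_prop) _ _]
        congr 1
        refine Finset.sum_congr rfl fun j _ => ?_
        rw [intervalIntegral.integral_const_mul, integral_pow]
        push_cast
        simp
        ring
    _ ≤ _ := ENNReal.ofReal_le_ofReal (sum_two_div_le (m + 1))

section UniformGaps

variable {𝒳 : Type*} [MeasurableSpace 𝒳] {K N : ℕ} {Θ : Type*} [MeasurableSpace Θ]
  {P : Measure Θ} {E : Θ → Env 𝒳 K N} {d : ℝ} {U : Fin (N - 2) → Θ → ℝ}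

theorem UniformGaps.lam_eq (h : UniformGaps P E d U) :
    ∀ᵐ θ ∂P, (E θ).lam = 1 + lamSum d fun i => U i θ := by
  filter_upwards [h.second, h.rest] with θ h2 h3
  rw [Env.lam, lamSum]
  congr 1
  rw [show Finset.Icc 2 (N - 1) = Finset.Ico (0 + 2) (N - 2 + 2) by
    ext k
    simp only [Finset.mem_Icc, Finset.mem_Ico]
    omega, ← Finset.sum_Ico_add', ← Finset.range_eq_Ico]
  refine Finset.sum_congr rfl fun m hm => ?_
  have hm := Finset.mem_range.1 hm
  rw [h3 (m + 2 + 1) (by omega) (by omega), show m + 2 + 1 - 2 = m + 1 by omega]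
  split_ifs with h0
  · rw [h0, h2]
  · rw [h3 (m + 2) (by omega) (by omega), Nat.add_sub_cancel]

theorem UniformGaps.integral_lam_le [IsProbabilityMeasure P] (h : UniformGaps P E d U)
    (hN : 2 ≤ N) (hd0 : 0 < d) (hd1 : d < 1) :
    Integrable (fun θ => (E θ).lam) P ∧ ∫ θ, (E θ).lam ∂P ≤ 1 + 2 * Real.log N := by
  have := isProbabilityMeasure_unifLaw hd1
  have hU : ∀ i, AEMeasurable (U i) P := fun i =>
    (h.uniform i).aemeasurable (by simp [hd1]) (by simp)
  have hUm : AEMeasurable (fun θ i => U i θ) P := aemeasurable_pi_lambda _ hU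
  have hmap : P.map (fun θ i => U i θ) = Measure.pi fun _ => unifLaw d := by
    rw [(iIndepFun_iff_map_fun_eq_pi_map hU).1 h.indep]
    congr 1
    funext i
    exact h.uniform i
  have hmem : ∀ᵐ θ ∂P, ∀ i, d ≤ U i θ := ae_all_iff.2 fun i => by
    refine ae_of_ae_map (hU i) (p := fun y => d ≤ y) ?_
    rw [show P.map (U i) = unifLaw d from h.uniform i]
    exact (ae_unifLaw_mem d).mono fun y hy => hy.1
  have hint : Integrable (fun θ => lamSum d fun i => U i θ) P :=
    Integrable.of_mem_Icc 0 (N - 2 : ℕ) ((measurable_lamSum d _).comp_aemeasurable hUm)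
      (hmem.mono fun θ hθ => lamSum_mem hd0 hθ)
  refine ⟨((integrable_const 1).add hint).congr (h.lam_eq.mono fun θ hθ => hθ.symm), ?_⟩
  rw [integral_congr_ae h.lam_eq, integral_add (integrable_const _) hint]
  have hle : ∫ θ, lamSum d (fun i => U i θ) ∂P ≤ 2 * Real.log ((N - 2 : ℕ) + 1) := by
    rw [integral_eq_lintegral_of_nonneg_ae (hmem.mono fun θ hθ => (lamSum_mem hd0 hθ).1)
      hint.aestronglyMeasurable]
    refine ENNReal.toReal_le_of_le_ofReal
      (mul_nonneg two_pos.le (Real.log_nonneg (by linarith [Nat.cast_nonneg (α := ℝ) (N - 2)]))) ?_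
    have := lintegral_lamSum_le hd0 hd1 (N - 2)
    rwa [← hmap, lintegral_map' (measurable_lamSum d _).ennreal_ofReal.aemeasurable hUm] at this
  have hlog : Real.log ((N - 2 : ℕ) + 1) ≤ Real.log N :=
    Real.log_le_log (by positivity) (by
      have : N - 2 + 1 ≤ N := by omega
      exact_mod_cast this)
  simp only [integral_const, probReal_univ, smul_eq_mul, one_mul]
  linarith

end UniformGaps

theorem lintegral_ofReal_le_of_ae_le {Θ : Type*} [MeasurableSpace Θ] (P : Measure Θ)
    [IsProbabilityMeasure P] {f : Θ → ℝ} {b : ℝ} (h : ∀ᵐ θ ∂P, f θ ≤ b) :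
    ∫⁻ θ, ENNReal.ofReal (f θ) ∂P ≤ ENNReal.ofReal b := by
  calc ∫⁻ θ, ENNReal.ofReal (f θ) ∂P ≤ ∫⁻ _, ENNReal.ofReal b ∂P :=
        lintegral_mono_ae (h.mono fun θ hθ => ENNReal.ofReal_le_ofReal hθ)
    _ = ENNReal.ofReal b := by simp

end StochasticExperts

namespace StochasticExperts

theorem one_half_le_log {N : ℕ} (hN : 2 ≤ N) : 1 / 2 ≤ Real.log N := by
  have : Real.log 2 ≤ Real.log N := Real.log_le_log two_pos (by exact_mod_cast hN)
  linarith [Real.log_two_gt_d9]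

theorem one_le_log_six_div {d : ℝ} (hd0 : 0 < d) (hd1 : d < 1) : 1 ≤ Real.log (6 / d) := by
  refine one_le_log_three.trans (Real.log_le_log (by norm_num) ?_)
  rw [le_div_iff₀ hd0]
  linarith

/-- A constant is absorbed by the logarithm of a large horizon. -/
theorem add_div_sq_le {R c A L X d M : ℝ} (hM : 1 ≤ M) (hL : 1 / 2 ≤ L) (hX : 1 ≤ X) {lT : ℝ}
    (hd0 : 0 < d) (hd1 : d < 1) (hc0 : 0 ≤ c) (hc : c ≤ lT) (hA : 0 ≤ A)
    (h : R ≤ c + 2 * (A * M ^ 2 * X * lT) / d) :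
    R / M ^ 2 ≤ (2 + 4 * A) * (L * X * lT / d) := by
  have hM2 : 1 ≤ M ^ 2 := one_le_pow₀ hM
  have hlT : 0 ≤ lT := hc0.trans hc
  set Y := X * lT / d with hY
  have hY0 : 0 ≤ Y := by positivity
  have h1 : lT ≤ Y := by
    rw [hY, le_div_iff₀ hd0]
    nlinarith
  have h2 : c ≤ Y * M ^ 2 := by nlinarith
  have h3 : 2 * (A * M ^ 2 * X * lT) / d = 2 * A * Y * M ^ 2 := by
    rw [hY]
    ring
  rw [div_le_iff₀ (by positivity), show L * X * lT / d = L * Y by rw [hY]; ring]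
  have h4 : (1 + 2 * A) * Y ≤ (2 + 4 * A) * (L * Y) := by
    have : 0 ≤ (2 + 4 * A) * Y := by positivity
    nlinarith
  have h5 := mul_le_mul_of_nonneg_right h4 (by positivity : 0 ≤ M ^ 2)
  rw [h3] at h
  linarith

theorem exists_forall_le_log (c : ℝ) : ∃ T₀ : ℕ, ∀ T : ℕ, T₀ ≤ T → c ≤ Real.log T :=
  Filter.eventually_atTop.1
    ((Real.tendsto_log_atTop.comp tendsto_natCast_atTop_atTop).eventually_ge_atTop c)

end StochasticExperts

theorem corollary2 :
    ∃ C : ℝ, 0 < C ∧ ∀ N : ℕ, 2 ≤ N → ∃ T₀ : ℕ,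
      ∀ (𝒳 Θ Ω : Type*) [MeasurableSpace 𝒳] [MeasurableSpace Θ] [MeasurableSpace Ω] (K : ℕ)
        (P : Measure Θ) [IsProbabilityMeasure P] (E : Θ → StochasticExperts.Env 𝒳 K N)
        (d : ℝ) (U : Fin (N - 2) → Θ → ℝ), 0 < d → d < 1 →
        StochasticExperts.UniformGaps P E d U →
        -- the parameter `λ(μ)`
        (Integrable (fun θ => (E θ).lam) P ∧
          ∫ θ, (E θ).lam ∂P ≤ 1 + 2 * Real.log N) ∧
        -- the clipped estimator
        ((∀ᵐ θ ∂P, ∀ i j, (E θ).FiniteDiv StochasticExperts.Env.fLog i j) →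
          ∀ run : (θ : Θ) → StochasticExperts.Run (E θ) Ω, (∀ᵐ θ ∂P, (run θ).IsClippedUCB) →
          ∀ T : ℕ, T₀ ≤ T →
            ∫⁻ θ, ENNReal.ofReal ((run θ).regret T / (E θ).logDivMax ^ 2) ∂P ≤
              ENNReal.ofReal
                (C * (Real.log N * Real.log (6 / d) ^ 2 * Real.log T / d))) ∧
        -- the median of means estimator
        ((∀ᵐ θ ∂P, ∀ i j, (E θ).FiniteDiv StochasticExperts.Env.fChi i j) →
          ∀ (G : StochasticExperts.Grouping N) (run : (θ : Θ) → StochasticExperts.Run (E θ) Ω),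
          (∀ᵐ θ ∂P, (run θ).IsMomUCB G) →
          ∀ T : ℕ, T₀ ≤ T →
            ∫⁻ θ, ENNReal.ofReal ((run θ).regret T / (E θ).chiDivMax ^ 2) ∂P ≤
              ENNReal.ofReal (C * (Real.log N * Real.log T / d))) := by
  refine ⟨2 + 4 * 512, by norm_num, fun N hN => ?_⟩
  obtain ⟨t₀, ht₀⟩ := StochasticExperts.exists_forall_momLarge N
  obtain ⟨T₀, hT₀⟩ := StochasticExperts.exists_forall_le_log (t₀ + 2 + 8 * N)
  refine ⟨T₀, ?_⟩
  intro 𝒳 Θ Ω _ _ _ K P _ E d U hd0 hd1 hU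
  have hL := StochasticExperts.one_half_le_log hN
  refine ⟨hU.integral_lam_le hN hd0 hd1, ?_, ?_⟩
  · intro hdiv run hrun T hT
    have hlog := hT₀ T hT
    have hX : 1 ≤ Real.log (6 / d) ^ 2 :=
      one_le_pow₀ (StochasticExperts.one_le_log_six_div hd0 hd1)
    refine StochasticExperts.lintegral_ofReal_le_of_ae_le P ?_
    filter_upwards [hdiv, hrun, hU.second] with θ h1 h2 h3
    have hM : 1 ≤ (E θ).logDivMax := ((E θ).one_le_logDiv (h1 ⟨0, by omega⟩ ⟨0, by omega⟩)).trans
      ((E θ).logDiv_le_logDivMax _ _)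
    refine StochasticExperts.add_div_sq_le hM hL hX hd0 hd1 (c := t₀ + 2 + 8 * N) (by positivity)
      hlog (by norm_num) (((run θ).regret_le_of_isClippedUCB h2 h1 hN hd0 h3 T).trans ?_)
    refine add_le_add (by linarith [Nat.cast_nonneg (α := ℝ) t₀]) ?_
    have : 0 ≤ Real.log T := Real.log_natCast_nonneg T
    gcongr
    norm_num
  · intro hdiv G run hrun T hT
    have hlog := hT₀ T hT
    refine StochasticExperts.lintegral_ofReal_le_of_ae_le P ?_
    filter_upwards [hdiv, hrun, hU.second] with θ h1 h2 h3
    have hM : 1 ≤ (E θ).chiDivMax := ((E θ).one_le_chiDiv (h1 ⟨0, by omega⟩ ⟨0, by omega⟩)).trans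
      ((E θ).chiDiv_le_chiDivMax _ _)
    have := StochasticExperts.add_div_sq_le hM hL le_rfl hd0 hd1 (c := t₀ + 2 + 8 * N)
      (A := 512) (R := (run θ).regret T) (by positivity) hlog (by norm_num)
      (((run θ).regret_le_of_isMomUCB G h2 h1 hN hd0 h3 ht₀ T).trans ?_)
    · simpa using this
    · rw [mul_one]
      linarith [Nat.cast_nonneg (α := ℝ) N]
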